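/- A Delzant polytope in $\mathbb{R}^n$ is a full-dimensional convex polytope $P\subset\mathbb{R}^n$ whose normal fan is unimodular: for every face $F$ of $P$, the normal cone $N(P,F)=\{\alpha\in(\mathbb{R}^n)^* : \langle\alpha,p-q\rangle\ge 0 \text{ for all } p\in F,\ q\in P\}$ is generated by linearly independent primitive integer vectors $v_1,\dots,v_m$ which generate (as a group) the lattice of integer vectors in their linear span. Let $\mathcal{D}(2)$ be the set of all Delzant polygons, i.e. Delzant polytopes in $\mathbb{R}^2$, with the topology induced by either of the two metrics $$\delta^H(P,Q)=\max\Big\{\max_{x\in P}\min_{y\in Q}\|x-y\|,\ \max_{y\in Q}\min_{x\in P}\|x-y\|\Big\},\qquad \delta^V(P,Q)=\operatorname{Vol}(P\setminus Q)+\operatorname{Vol}(Q\setminus P).$$ Then $\mathcal{D}(2)$ is simply connected: for each of these two topologies, it is nonempty and path connected and every loop in it is null-homotopic. -/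

import Mathlib

open MeasureTheory

namespace DelzantModuli

/-- The lattice `ℤⁿ` of vectors with integer coordinates in Euclidean space `ℝⁿ`. -/
def integerLattice (n : ℕ) : AddSubgroup (EuclideanSpace ℝ (Fin n)) where
  carrier := {x | ∀ i, ∃ k : ℤ, x i = (k : ℝ)}
  zero_mem' := fun _ => ⟨0, by simp⟩
  add_mem' := by
    intro x y hx hy i
    obtain ⟨a, ha⟩ := hx i
    obtain ⟨b, hb⟩ := hy i
    exact ⟨a + b, by simp [ha, hb]⟩
  neg_mem' := by
    intro x hx i
    obtain ⟨a, ha⟩ := hx i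
    exact ⟨-a, by simp [ha]⟩

/-- A primitive vector: an integer vector whose coordinates have greatest common divisor `1`
(in particular it is nonzero). -/
def IsPrimitive {n : ℕ} (v : EuclideanSpace ℝ (Fin n)) : Prop :=
  ∃ z : Fin n → ℤ, (∀ i, v i = (z i : ℝ)) ∧ Finset.univ.gcd z = 1

/-- The cone generated by finitely many vectors. -/
def coneOf {n m : ℕ} (v : Fin m → EuclideanSpace ℝ (Fin n)) : Set (EuclideanSpace ℝ (Fin n)) :=
  {x | ∃ a : Fin m → ℝ, (∀ i, 0 ≤ a i) ∧ x = ∑ i, a i • v i}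

/-- The multiplicity of the simplicial cone `C` with primitive ray generators `v`: the index of the
sublattice generated by the `v i` in the lattice `ℝC ∩ ℤⁿ`. -/
noncomputable def coneMultiplicity {n m : ℕ} (v : Fin m → EuclideanSpace ℝ (Fin n)) : ℕ :=
  (AddSubgroup.closure (Set.range v)).relIndex
    ((Submodule.span ℝ (coneOf v)).toAddSubgroup ⊓ integerLattice n)

/-- A unimodular cone: a rational simplicial cone of multiplicity one. The zero cone is the case
`m = 0`. -/
def IsUnimodularCone {n : ℕ} (C : Set (EuclideanSpace ℝ (Fin n))) : Prop :=
  ∃ (m : ℕ) (v : Fin m → EuclideanSpace ℝ (Fin n)),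
    (∀ i, IsPrimitive (v i)) ∧ LinearIndependent ℝ v ∧ C = coneOf v ∧ coneMultiplicity v = 1

/-- The face of `P` in the direction `α`. The dual space of `ℝⁿ` is identified with `ℝⁿ` by the
standard inner product. -/
def face {n : ℕ} (P : Set (EuclideanSpace ℝ (Fin n))) (α : EuclideanSpace ℝ (Fin n)) :
    Set (EuclideanSpace ℝ (Fin n)) :=
  {p | p ∈ P ∧ ∀ x ∈ P, inner ℝ α x ≤ inner ℝ α p}

/-- The normal cone of a face `F` of `P`. -/
def normalCone {n : ℕ} (P F : Set (EuclideanSpace ℝ (Fin n))) :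
    Set (EuclideanSpace ℝ (Fin n)) :=
  {α | F ⊆ face P α}

/-- The normal fan of `P`: the collection of the normal cones of all faces of `P`. -/
def normalFan {n : ℕ} (P : Set (EuclideanSpace ℝ (Fin n))) :
    Set (Set (EuclideanSpace ℝ (Fin n))) :=
  {C | ∃ α, C = normalCone P (face P α)}

/-- A Delzant polytope in `ℝⁿ`: a (nonempty) full-dimensional convex polytope whose normal fan is
unimodular, that is, all of whose normal cones are rational, simplicial and of multiplicity one.
(The normal fan of a polytope is always a complete fan, so nothing else has to be required.) -/
def IsDelzant {n : ℕ} (P : ConvexBody (EuclideanSpace ℝ (Fin n))) : Prop :=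
  (∃ S : Finset (EuclideanSpace ℝ (Fin n)),
    (P : Set (EuclideanSpace ℝ (Fin n))) = convexHull ℝ (S : Set (EuclideanSpace ℝ (Fin n)))) ∧
  affineSpan ℝ (P : Set (EuclideanSpace ℝ (Fin n))) = ⊤ ∧
  ∀ C ∈ normalFan (P : Set (EuclideanSpace ℝ (Fin n))), IsUnimodularCone C

/-- The set `𝒟(n)` of all Delzant polytopes in `ℝⁿ`. -/
def DelzantPolytope (n : ℕ) : Type :=
  {P : ConvexBody (EuclideanSpace ℝ (Fin n)) // IsDelzant P}

/-- The underlying set of points of a Delzant polytope. -/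
def DelzantPolytope.toSet {n : ℕ} (P : DelzantPolytope n) : Set (EuclideanSpace ℝ (Fin n)) :=
  (P.1 : Set (EuclideanSpace ℝ (Fin n)))

/-- The Hausdorff distance on `𝒟(n)`. -/
noncomputable abbrev hausdorffMetric (n : ℕ) : PseudoMetricSpace (DelzantPolytope n) where
  dist P Q := Metric.hausdorffDist P.toSet Q.toSet
  dist_self _ := Metric.hausdorffDist_self_zero
  dist_comm _ _ := Metric.hausdorffDist_comm
  dist_triangle _ _ _ := Metric.hausdorffDist_triangle ConvexBody.hausdorffEDist_ne_top

/-- The symmetric difference distance `Vol (P \ Q) + Vol (Q \ P)` on `𝒟(n)`. -/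
noncomputable abbrev symmDiffMetric (n : ℕ) : PseudoMetricSpace (DelzantPolytope n) where
  dist P Q := volume.real (P.toSet \ Q.toSet) + volume.real (Q.toSet \ P.toSet)
  dist_self P := by simp
  dist_comm P Q := add_comm _ _
  dist_triangle P Q R := by
    have key : ∀ A B C : DelzantPolytope n, volume.real (A.toSet \ C.toSet) ≤
        volume.real (A.toSet \ B.toSet) + volume.real (B.toSet \ C.toSet) := by
      intro A B C
      have hfin : ∀ A B : DelzantPolytope n, volume (A.toSet \ B.toSet) ≠ ⊤ := fun A B =>
        ((measure_mono Set.sdiff_subset).trans_lt A.1.isCompact.measure_lt_top).ne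
      refine (measureReal_mono (s₂ := A.toSet \ B.toSet ∪ B.toSet \ C.toSet) ?_
        (measure_union_ne_top (hfin A B) (hfin B C))).trans (measureReal_union_le _ _)
      rintro x ⟨hA, hC⟩
      by_cases hB : x ∈ B.toSet
      · exact Or.inr ⟨hB, hC⟩
      · exact Or.inl ⟨hA, hB⟩
    linarith [key P Q R, key R Q P]

/-- The topology of `𝒟(n)` induced by the Hausdorff distance. -/
noncomputable abbrev hausdorffTopology (n : ℕ) : TopologicalSpace (DelzantPolytope n) :=
  (hausdorffMetric n).toUniformSpace.toTopologicalSpace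

/-- The topology of `𝒟(n)` induced by the symmetric difference distance. -/
noncomputable abbrev symmDiffTopology (n : ℕ) : TopologicalSpace (DelzantPolytope n) :=
  (symmDiffMetric n).toUniformSpace.toTopologicalSpace

/-- The set `X` with the topology `t` is simply connected: nonempty, path connected and with trivial
fundamental group. (Mathlib's notion, with the topology as an explicit argument.) -/
def SimplyConnectedWith {X : Type} (t : TopologicalSpace X) : Prop :=
  @SimplyConnectedSpace X t

end DelzantModuli

/-! ### A criterion for simple connectivity from natural paths. -/

section SimplyConnectedCriterion

open unitInterval Filter Topology

variable {X : Type*} [TopologicalSpace X]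

/-! If the normal fan of `P` refines that of `Q`, then `(1 - t) P + t Q` has the normal fan of `P`
for all `t < 1`, so Minkowski interpolation is a path of Delzant polygons from `P` to `Q`, depending
continuously on `P` and `Q`. For arbitrary `P` and `Q` this fails, because the common refinement of
two unimodular fans need not be unimodular.

Two facts make this partial convexity sufficient. By `eventually_refines`, Delzant polygons
Hausdorff-close to `Q` have fans refining that of `Q`: an edge of `Q` cannot be cut away in a nearby
polygon, since integrality and unimodularity forbid a new vertex there. By
`eventually_refines_fareyZonotope`, the zonotopes spanned by all integer vectors of a box of size
`N` are Delzant (their rays are the Farey directions of order `N`), and for large `N` they refine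
any given Delzant polygon.

Given a path, cut it into pieces, each retracting to a nearby polygon along interpolation paths. For
large `N` the Farey zonotope refines all division points and all these centres, and the
interpolation paths from it fill the resulting triangles. So each path is homotopic to one that
depends only on its endpoints and `N` (`simplyConnectedSpace_of_naturalPaths`).

This settles the Hausdorff topology. The volume topology is the same one: near a body with interior,
both distances are controlled by slight homotheties about an interior point
(`hausdorffTopology_eq_symmDiffTopology`). -/

/-- The boundary of a continuous square commutes up to homotopy. -/
theorem Path.homotopic_of_square {a b c d : X} (p : Path a b) (q : Path c d) (l : Path a c)
    (r : Path b d) (F : I × I → X) (hF : Continuous F) (hp : ∀ s, F (0, s) = p s)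
    (hq : ∀ s, F (1, s) = q s) (hl : ∀ t, F (t, 0) = l t) (hr : ∀ t, F (t, 1) = r t) :
    (p.trans r).Homotopic (l.trans q) := by
  obtain rfl : F (0, 0) = a := by simp [hp]
  obtain rfl : F (0, 1) = b := by simp [hp]
  obtain rfl : F (1, 0) = c := by simp [hq]
  obtain rfl : F (1, 1) = d := by simp [hq]
  let f : C(I, X) := ⟨fun s => F (0, s), by fun_prop⟩
  let g : C(I, X) := ⟨fun s => F (1, s), by fun_prop⟩
  let H : f.Homotopy g := ⟨⟨F, hF⟩, fun _ => rfl, fun _ => rfl⟩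
  let id01 : Path (0 : I) 1 := ⟨⟨id, continuous_id⟩, rfl, rfl⟩
  have key := Path.Homotopic.map_trans_evalAt H id01
  have e1 : id01.map f.continuous = p := by ext s; exact hp s
  have e2 : id01.map g.continuous = q := by ext s; exact hq s
  have e3 : H.evalAt 0 = l := by ext s; exact hl s
  have e4 : H.evalAt 1 = r := by ext s; exact hr s
  rw [← e1, ← e2, ← e3, ← e4]
  exact key

/-- A space with a relation `R`, and natural paths between related points, is simply connected if
points near `Q` are related to `Q` and some sequence is eventually related to every point. -/
theorem simplyConnectedSpace_of_naturalPaths [Nonempty X] (R : X → X → Prop)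
    (pth : ∀ P Q, R P Q → Path P Q)
    (hpth : ∀ (f g : I → X) (h : ∀ s, R (f s) (g s)), Continuous f → Continuous g →
      Continuous fun p : I × I => pth (f p.2) (g p.2) (h p.2) p.1)
    (hR : ∀ Q, ∀ᶠ P in 𝓝 Q, R P Q)
    (hRpth : ∀ {Z P Q} (h : R P Q), R Z P → R Z Q → ∀ t, R Z (pth P Q h t))
    (Z : ℕ → X) (hZ : ∀ P, ∀ᶠ N in atTop, R (Z N) P) : SimplyConnectedSpace X := by
  -- The paths from `A` to the points of `pth P Q` sweep out a square with one side constant at `A`,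
  -- that is, a filled triangle.
  have tri : ∀ {A P Q : X} (h : R P Q) (hP : R A P) (hQ : R A Q),
      (Path.Homotopic.Quotient.mk (pth A P hP)).trans (.mk (pth P Q h)) = .mk (pth A Q hQ) := by
    intro A P Q h hP hQ
    have hA : ∀ s, R A (pth P Q h s) := hRpth h hP hQ
    have := Path.homotopic_of_square (Path.refl A) (pth P Q h) (pth A P hP) (pth A Q hQ)
      (fun p => pth A (pth P Q h p.2) (hA p.2) p.1)
      (hpth (fun _ => A) (pth P Q h) hA continuous_const (pth P Q h).continuous)
      (by simp) (by simp) (fun t => by congr! <;> simp) (fun t => by congr! <;> simp)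
    have := Path.Homotopic.Quotient.eq.mpr this
    simpa [Path.Homotopic.Quotient.mk_trans] using this.symm
  -- All of `γ` slides into `Q`, so `γ` followed by `pth y Q` is homotopic to `pth x Q`. Two
  -- triangles with apex `A` then allow `pth y Q` to be cancelled.
  have loc : ∀ {A x y Q : X} (γ : Path x y) (h : ∀ s, R (γ s) Q) (hx : R A x) (hy : R A y)
      (hQ : R A Q), (Path.Homotopic.Quotient.mk (pth A x hx)).trans (.mk γ) = .mk (pth A y hy) := by
    intro A x y Q γ h hx hy hQ
    have hxQ : R x Q := by simpa using h 0
    have hyQ : R y Q := by simpa using h 1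
    have := Path.homotopic_of_square γ (Path.refl Q) (pth x Q hxQ) (pth y Q hyQ)
      (fun p => pth (γ p.2) Q (h p.2) p.1)
      (hpth γ (fun _ => Q) h γ.continuous continuous_const)
      (by simp) (by simp) (fun t => by congr! <;> simp) (fun t => by congr! <;> simp)
    have e := Path.Homotopic.Quotient.eq.mpr this
    simp only [Path.Homotopic.Quotient.mk_trans, Path.Homotopic.Quotient.mk_refl,
      Path.Homotopic.Quotient.trans_refl] at e
    have e2 := (congrArg (Path.Homotopic.Quotient.trans (.mk (pth A x hx))) e).trans
      ((tri hxQ hx hQ).trans (tri hyQ hy hQ).symm)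
    have e3 := congrArg (fun u => u.trans (Path.Homotopic.Quotient.mk (pth y Q hyQ)).symm) e2
    simpa [Path.Homotopic.Quotient.trans_assoc] using e3
  have glob : ∀ {x y : X} (γ : Path x y), ∀ᶠ N in atTop, ∀ (hx : R (Z N) x) (hy : R (Z N) y),
      (Path.Homotopic.Quotient.mk (pth (Z N) x hx)).trans (.mk γ) = .mk (pth (Z N) y hy) := by
    intro x y γ
    -- Lebesgue number argument: every piece of the subdivision lies in the set of points related to
    -- a single point of `γ`.
    obtain ⟨t, ht0, htm, ⟨n, hn⟩, ht⟩ := exists_monotone_Icc_subset_open_cover_unitInterval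
      (c := fun s : I => interior {u | R (γ u) (γ s)}) (fun _ => isOpen_interior)
      (fun s _ => Set.mem_iUnion.mpr ⟨s, mem_interior_iff_mem_nhds.mpr
        (γ.continuous.continuousAt.eventually (hR (γ s)))⟩)
    have claim : ∀ n, ∀ᶠ N in atTop, ∀ (h0 : R (Z N) (γ (t 0))) (h1 : R (Z N) (γ (t n))),
        (Path.Homotopic.Quotient.mk (pth (Z N) _ h0)).trans (.mk (γ.subpath (t 0) (t n))) =
          .mk (pth (Z N) _ h1) := by
      intro n
      induction n with
      | zero => exact Eventually.of_forall fun N h0 h1 => by simp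
      | succ n ih =>
        obtain ⟨s, hs⟩ := ht n
        -- `Z N` has to be related only to the division points and to the centres `γ s`, which are
        -- finitely many, and not to every point of `γ`.
        filter_upwards [ih, hZ (γ (t n)), hZ (γ s)] with N ihN h1 hs' h0 h2
        have h := Path.Homotopic.Quotient.eq.mpr
          ⟨Path.Homotopy.subpathTransSubpath γ (t 0) (t n) (t (n + 1))⟩
        rw [Path.Homotopic.Quotient.mk_trans] at h
        rw [← h, ← Path.Homotopic.Quotient.trans_assoc, ihN h0 h1]
        refine loc (Q := γ s) _ (fun u => ?_) h1 h2 hs'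
        have hu : γ.subpath (t n) (t (n + 1)) u ∈ Set.range (γ.subpath (t n) (t (n + 1))) :=
          ⟨u, rfl⟩
        rw [Path.range_subpath_of_le _ _ _ (htm n.le_succ)] at hu
        obtain ⟨v, hv, hvu⟩ := hu
        rw [← hvu]
        exact (interior_subset (hs hv) : v ∈ {u | R (γ u) (γ s)})
    have h := claim n
    rw [ht0, hn n le_rfl] at h
    rw [Path.subpath_zero_one] at h
    -- The ends `γ 0` and `γ 1` equal `x` and `y` only propositionally; generalizing them lets the
    -- equalities be substituted.
    have cast : ∀ (a b : X) (ha : a = x) (hb : b = y),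
        (∀ᶠ N in atTop, ∀ (hx : R (Z N) a) (hy : R (Z N) b),
          (Path.Homotopic.Quotient.mk (pth (Z N) a hx)).trans (.mk (γ.cast ha hb)) =
            .mk (pth (Z N) b hy)) →
        ∀ᶠ N in atTop, ∀ (hx : R (Z N) x) (hy : R (Z N) y),
          (Path.Homotopic.Quotient.mk (pth (Z N) x hx)).trans (.mk γ) = .mk (pth (Z N) y hy) := by
      rintro _ _ rfl rfl h
      exact h
    exact cast _ _ γ.source γ.target h
  refine simply_connected_iff_paths_homotopic'.mpr ⟨⟨inferInstance, fun x y => ?_⟩, ?_⟩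
  · obtain ⟨N, hx, hy⟩ := ((hZ x).and (hZ y)).exists
    exact ⟨(pth _ _ hx).symm.trans (pth _ _ hy)⟩
  · intro x y p q
    obtain ⟨N, hx, hy, hp, hq⟩ := ((hZ x).and ((hZ y).and ((glob p).and (glob q)))).exists
    have e := congrArg (Path.Homotopic.Quotient.trans (Path.Homotopic.Quotient.mk (pth _ _ hx)).symm)
      ((hp hx hy).trans (hq hx hy).symm)
    rw [← Path.Homotopic.Quotient.trans_assoc, ← Path.Homotopic.Quotient.trans_assoc] at e
    exact Path.Homotopic.Quotient.eq.mp (by simpa using e)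

end SimplyConnectedCriterion

/-! ### Normal cones, Minkowski sums and refinement of fans in any dimension. -/

namespace DelzantModuli

open Filter Pointwise
open scoped RealInnerProductSpace

variable {n : ℕ}

/-- The normal cone of the face of `P` in direction `α`, i.e. the cone of the normal fan of `P`
with `α` in its relative interior. -/
def localCone (P : Set (EuclideanSpace ℝ (Fin n))) (α : EuclideanSpace ℝ (Fin n)) :
    Set (EuclideanSpace ℝ (Fin n)) :=
  normalCone P (face P α)

theorem mem_localCone {P : Set (EuclideanSpace ℝ (Fin n))} {α β : EuclideanSpace ℝ (Fin n)} :
    β ∈ localCone P α ↔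
      ∀ p ∈ P, (∀ x ∈ P, ⟪α, x⟫ ≤ ⟪α, p⟫) → ∀ x ∈ P, ⟪β, x⟫ ≤ ⟪β, p⟫ :=
  ⟨fun h _ hp hα => (h ⟨hp, hα⟩).2, fun h _ hp => ⟨hp.1, h _ hp.1 hp.2⟩⟩

theorem self_mem_localCone (P : Set (EuclideanSpace ℝ (Fin n))) (α : EuclideanSpace ℝ (Fin n)) :
    α ∈ localCone P α :=
  mem_localCone.mpr fun _ _ h => h

theorem exists_inner_max (P : ConvexBody (EuclideanSpace ℝ (Fin n)))
    (α : EuclideanSpace ℝ (Fin n)) : ∃ p ∈ P, ∀ x ∈ P, ⟪α, x⟫ ≤ ⟪α, p⟫ :=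
  P.isCompact.exists_isMaxOn P.nonempty (f := fun x => ⟪α, x⟫) (by fun_prop)

/-- A linear functional attains its maximum on `P + Q` exactly at sums of maximizers, so a face of
the sum is the sum of the faces. -/
theorem localCone_add (P Q : ConvexBody (EuclideanSpace ℝ (Fin n)))
    (α : EuclideanSpace ℝ (Fin n)) :
    localCone (↑(P + Q)) α = localCone (P : Set _) α ∩ localCone (Q : Set _) α := by
  ext β
  simp only [Set.mem_inter_iff, mem_localCone, ConvexBody.coe_add]
  constructor
  · intro h
    obtain ⟨p, hp, hpα⟩ := exists_inner_max P α
    obtain ⟨q, hq, hqα⟩ := exists_inner_max Q α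
    constructor
    · intro p' hp' hp'α x hx
      have := h (p' + q) (Set.add_mem_add hp' hq) ?_ (x + q) (Set.add_mem_add hx hq)
      · simpa [inner_add_right] using this
      · rintro _ ⟨a, ha, b, hb, rfl⟩
        simp only [inner_add_right]
        exact add_le_add (hp'α a ha) (hqα b hb)
    · intro q' hq' hq'α x hx
      have := h (p + q') (Set.add_mem_add hp hq') ?_ (p + x) (Set.add_mem_add hp hx)
      · simpa [inner_add_right] using this
      · rintro _ ⟨a, ha, b, hb, rfl⟩
        simp only [inner_add_right]
        exact add_le_add (hpα a ha) (hq'α b hb)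
  · rintro ⟨h1, h2⟩ _ ⟨p, hp, q, hq, rfl⟩ hα _ ⟨x, hx, y, hy, rfl⟩
    simp only [inner_add_right]
    refine add_le_add (h1 p hp (fun a ha => ?_) x hx) (h2 q hq (fun b hb => ?_) y hy)
    · simpa [inner_add_right] using hα (a + q) (Set.add_mem_add ha hq)
    · simpa [inner_add_right] using hα (p + b) (Set.add_mem_add hp hb)

theorem localCone_smul (P : ConvexBody (EuclideanSpace ℝ (Fin n))) {c : ℝ} (hc : 0 < c)
    (α : EuclideanSpace ℝ (Fin n)) : localCone (↑(c • P)) α = localCone (P : Set _) α := by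
  ext β
  simp only [mem_localCone, ConvexBody.coe_smul, Set.mem_smul_set, forall_exists_index, and_imp,
    forall_apply_eq_imp_iff₂, inner_smul_right, mul_le_mul_iff_right₀ hc]

theorem localCone_sum {ι : Type*} (s : Finset ι)
    (K : ι → ConvexBody (EuclideanSpace ℝ (Fin n))) (α : EuclideanSpace ℝ (Fin n)) :
    localCone (↑(∑ i ∈ s, K i)) α = ⋂ i ∈ s, localCone (K i : Set _) α := by
  classical
  induction s using Finset.induction_on with
  | empty =>
    ext β
    simp [mem_localCone]
  | insert i s hi ih => rw [Finset.sum_insert hi, localCone_add, ih, Finset.set_biInter_insert]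

/-- The body `P` is a convex polytope. -/
def IsPolytope (P : ConvexBody (EuclideanSpace ℝ (Fin n))) : Prop :=
  ∃ S : Finset (EuclideanSpace ℝ (Fin n)),
    (P : Set (EuclideanSpace ℝ (Fin n))) = convexHull ℝ (S : Set (EuclideanSpace ℝ (Fin n)))

theorem IsPolytope.add {P Q : ConvexBody (EuclideanSpace ℝ (Fin n))} (hP : IsPolytope P)
    (hQ : IsPolytope Q) : IsPolytope (P + Q) := by
  classical
  obtain ⟨S, hS⟩ := hP
  obtain ⟨T, hT⟩ := hQ
  exact ⟨S + T, by rw [ConvexBody.coe_add, hS, hT, Finset.coe_add, convexHull_add]⟩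

theorem IsPolytope.smul {P : ConvexBody (EuclideanSpace ℝ (Fin n))} (hP : IsPolytope P) (c : ℝ) :
    IsPolytope (c • P) := by
  classical
  obtain ⟨S, hS⟩ := hP
  exact ⟨c • S, by rw [ConvexBody.coe_smul, hS, Finset.coe_smul_finset, convexHull_smul]⟩

theorem IsPolytope.sum {ι : Type*} (s : Finset ι)
    {K : ι → ConvexBody (EuclideanSpace ℝ (Fin n))} (h : ∀ i ∈ s, IsPolytope (K i)) :
    IsPolytope (∑ i ∈ s, K i) := by
  classical
  induction s using Finset.induction_on with
  | empty => exact ⟨{0}, by simp [Set.singleton_zero]⟩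
  | insert i s hi ih =>
    rw [Finset.sum_insert hi]
    exact (h i (by simp)).add (ih fun j hj => h j (by simp [hj]))

theorem inner_le_of_mem_convexHull {S : Set (EuclideanSpace ℝ (Fin n))}
    {γ : EuclideanSpace ℝ (Fin n)} {c : ℝ} (h : ∀ s ∈ S, ⟪γ, s⟫ ≤ c)
    {x : EuclideanSpace ℝ (Fin n)} (hx : x ∈ convexHull ℝ S) : ⟪γ, x⟫ ≤ c := by
  have hconv : Convex ℝ {x | ⟪γ, x⟫ ≤ c} :=
    convex_halfSpace_le (innerₗ _ γ).isLinear c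
  exact convexHull_min (fun s hs => h s hs) hconv hx

/-- Polyhedrality enters through this finite comparison: a functional that is harmless where `f`
vanishes is dominated by a large multiple of `f`. -/
theorem exists_pos_forall_le_mul {ι : Type*} (S : Finset ι) (f g : ι → ℝ)
    (hf : ∀ s ∈ S, 0 ≤ f s) (hg : ∀ s ∈ S, f s = 0 → g s ≤ 0) :
    ∃ K : ℝ, 0 < K ∧ ∀ s ∈ S, g s ≤ K * f s := by
  have : ∀ᶠ K : ℝ in atTop, ∀ s ∈ S, g s ≤ K * f s := by
    rw [eventually_all_finset]
    intro s hs
    rcases (hf s hs).eq_or_lt with h | h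
    · exact Eventually.of_forall fun K => by rw [← h, mul_zero]; exact hg s hs h.symm
    · filter_upwards [eventually_ge_atTop (g s / f s)] with K hK
      rwa [div_le_iff₀ h] at hK
  obtain ⟨K, hK, h⟩ := ((eventually_gt_atTop 0).and this).exists
  exact ⟨K, hK, h⟩

theorem exists_mem_of_convexHull_max {P : ConvexBody (EuclideanSpace ℝ (Fin n))}
    {S : Finset (EuclideanSpace ℝ (Fin n))}
    (hS : (P : Set (EuclideanSpace ℝ (Fin n))) = convexHull ℝ (S : Set _))
    (α : EuclideanSpace ℝ (Fin n)) : ∃ s ∈ S, s ∈ P ∧ ∀ x ∈ P, ⟪α, x⟫ ≤ ⟪α, s⟫ := by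
  have hne : S.Nonempty := by
    rw [← Finset.coe_nonempty, ← convexHull_nonempty_iff (𝕜 := ℝ), ← hS]
    exact P.nonempty
  obtain ⟨s, hs, hmax⟩ := S.exists_max_image (fun s => ⟪α, s⟫) hne
  refine ⟨s, hs, ?_, fun x hx => ?_⟩
  · rw [← SetLike.mem_coe, hS]
    exact subset_convexHull ℝ _ hs
  · rw [← SetLike.mem_coe, hS] at hx
    exact inner_le_of_mem_convexHull hmax hx

/-- It suffices to test generators: for large `K` the functional `K • α - β` is maximal over the
hull at `s₀`, so among maximizers of `α` the value of `β` is at least that at `s₀`. -/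
theorem mem_localCone_iff_of_convexHull {P : ConvexBody (EuclideanSpace ℝ (Fin n))}
    {S : Finset (EuclideanSpace ℝ (Fin n))}
    (hS : (P : Set (EuclideanSpace ℝ (Fin n))) = convexHull ℝ (S : Set _))
    {α β : EuclideanSpace ℝ (Fin n)} :
    β ∈ localCone (P : Set _) α ↔
      ∀ s ∈ S, (∀ x ∈ P, ⟪α, x⟫ ≤ ⟪α, s⟫) → ∀ x ∈ P, ⟪β, x⟫ ≤ ⟪β, s⟫ := by
  have hSP : ∀ s ∈ S, s ∈ P := fun s hs => by
    rw [← SetLike.mem_coe, hS]; exact subset_convexHull ℝ _ hs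
  rw [mem_localCone]
  refine ⟨fun h s hs hα => h s (hSP s hs) hα, fun h p hp hpα x hx => ?_⟩
  obtain ⟨s₀, hs₀, hs₀P, hmax⟩ := exists_mem_of_convexHull_max hS α
  have hβ := h s₀ hs₀ hmax
  obtain ⟨K, -, hK⟩ := exists_pos_forall_le_mul S (fun s => ⟪α, s₀⟫ - ⟪α, s⟫)
    (fun s => ⟪β, s₀⟫ - ⟪β, s⟫) (fun s hs => sub_nonneg.mpr (hmax s (hSP s hs)))
    (fun s hs h0 => sub_nonpos.mpr (h s hs (fun y hy => (hmax y hy).trans (by linarith)) s₀ hs₀P))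
  have hp' : p ∈ convexHull ℝ (S : Set _) := by rw [← hS]; exact hp
  have key : ⟪K • α - β, p⟫ ≤ K * ⟪α, s₀⟫ - ⟪β, s₀⟫ := by
    refine inner_le_of_mem_convexHull (fun s hs => ?_) hp'
    rw [inner_sub_left, real_inner_smul_left]
    linarith [hK s hs]
  rw [inner_sub_left, real_inner_smul_left, le_antisymm (hmax p hp) (hpα s₀ hs₀P)] at key
  exact (hβ x hx).trans (by linarith)

/-- A cone is determined by the subset of generators on which its direction is maximal. -/
theorem finite_normalFan {P : ConvexBody (EuclideanSpace ℝ (Fin n))} (hP : IsPolytope P) :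
    (normalFan (P : Set (EuclideanSpace ℝ (Fin n)))).Finite := by
  obtain ⟨S, hS⟩ := hP
  refine ((S : Set _).toFinite.finite_subsets.image fun T : Set (EuclideanSpace ℝ (Fin n)) =>
    {β : EuclideanSpace ℝ (Fin n) | ∀ s ∈ T, ∀ x ∈ P, ⟪β, x⟫ ≤ ⟪β, s⟫}).subset ?_
  rintro _ ⟨α, rfl⟩
  refine ⟨{s | s ∈ S ∧ ∀ x ∈ P, ⟪α, x⟫ ≤ ⟪α, s⟫}, fun s hs => hs.1, ?_⟩
  ext β
  refine Iff.trans ?_ (mem_localCone_iff_of_convexHull hS).symm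
  simp

/-- The cone `localCone P α` is relatively open around `α`, in its linear span. -/
theorem IsPolytope.exists_add_smul_mem_localCone {P : ConvexBody (EuclideanSpace ℝ (Fin n))}
    (hP : IsPolytope P) {α β : EuclideanSpace ℝ (Fin n)}
    (h : ∀ p ∈ face (P : Set _) α, ∀ q ∈ face (P : Set _) α, ⟪β, p⟫ = ⟪β, q⟫) :
    ∃ ε : ℝ, 0 < ε ∧ α + ε • β ∈ localCone (P : Set _) α := by
  obtain ⟨S, hS⟩ := hP
  have hSP : ∀ s ∈ S, s ∈ P := fun s hs => by
    rw [← SetLike.mem_coe, hS]; exact subset_convexHull ℝ _ hs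
  obtain ⟨s₀, hs₀, hs₀P, hmax⟩ := exists_mem_of_convexHull_max hS α
  obtain ⟨K, hK0, hK⟩ := exists_pos_forall_le_mul S (fun s => ⟪α, s₀⟫ - ⟪α, s⟫)
    (fun s => ⟪β, s⟫ - ⟪β, s₀⟫) (fun s hs => sub_nonneg.mpr (hmax s (hSP s hs)))
    (fun s hs h0 => sub_nonpos.mpr (h s ⟨hSP s hs, fun y hy => (hmax y hy).trans (by linarith)⟩
      s₀ ⟨hs₀P, hmax⟩).le)
  refine ⟨K⁻¹, inv_pos.mpr hK0, mem_localCone.mpr fun p hp hpα x hx => ?_⟩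
  have hx' : x ∈ convexHull ℝ (S : Set _) := by rw [← hS]; exact hx
  have hβp := h p ⟨hp, hpα⟩ s₀ ⟨hs₀P, hmax⟩
  have hαp := le_antisymm (hmax p hp) (hpα s₀ hs₀P)
  refine inner_le_of_mem_convexHull (fun s hs => ?_) hx'
  have h1 := mul_le_mul_of_nonneg_left (hK s hs) (inv_pos.mpr hK0).le
  rw [inv_mul_cancel_left₀ hK0.ne'] at h1
  simp only [inner_add_left, real_inner_smul_left, hβp, hαp]
  linarith

/-- The cone at `0` consists of the functionals constant on `P`, the orthogonal complement of its
direction space. -/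
theorem localCone_zero_subset_iff (P : ConvexBody (EuclideanSpace ℝ (Fin n))) :
    affineSpan ℝ (P : Set (EuclideanSpace ℝ (Fin n))) = ⊤ ↔
      localCone (P : Set (EuclideanSpace ℝ (Fin n))) 0 ⊆ {0} := by
  rw [AffineSubspace.affineSpan_eq_top_iff_vectorSpan_eq_top_of_nonempty ℝ _ _ P.nonempty]
  constructor
  · intro h β hβ
    rw [mem_localCone] at hβ
    have hle : vectorSpan ℝ (P : Set (EuclideanSpace ℝ (Fin n))) ≤
        LinearMap.ker (innerₗ (EuclideanSpace ℝ (Fin n)) β) := by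
      rw [vectorSpan_def, Submodule.span_le]
      rintro _ ⟨x, hx, y, hy, rfl⟩
      have h1 := hβ x hx (by simp) y hy
      have h2 := hβ y hy (by simp) x hx
      simp only [SetLike.mem_coe, LinearMap.mem_ker, innerₗ_apply_apply, vsub_eq_sub,
        inner_sub_right]
      linarith
    rw [h] at hle
    have : β ∈ LinearMap.ker (innerₗ (EuclideanSpace ℝ (Fin n)) β) := hle trivial
    simpa using this
  · intro h
    rw [← Submodule.orthogonal_eq_bot_iff, Submodule.eq_bot_iff]
    intro β hβ
    refine h (mem_localCone.mpr fun p hp _ x hx => ?_)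
    have := (Submodule.mem_orthogonal _ _).mp hβ (x -ᵥ p) (vsub_mem_vectorSpan ℝ hx hp)
    rw [vsub_eq_sub, inner_sub_left, real_inner_comm, real_inner_comm β p] at this
    linarith

theorem isDelzant_iff {P : ConvexBody (EuclideanSpace ℝ (Fin n))} :
    IsDelzant P ↔ IsPolytope P ∧ localCone (P : Set (EuclideanSpace ℝ (Fin n))) 0 ⊆ {0} ∧
      ∀ α, IsUnimodularCone (localCone (P : Set (EuclideanSpace ℝ (Fin n))) α) := by
  rw [← localCone_zero_subset_iff]
  refine and_congr Iff.rfl (and_congr Iff.rfl ⟨fun h α => h _ ⟨α, rfl⟩, ?_⟩)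
  rintro h _ ⟨α, rfl⟩
  exact h α

/-- The normal fan of `P` refines the normal fan of `Q`. -/
def Refines (P Q : ConvexBody (EuclideanSpace ℝ (Fin n))) : Prop :=
  ∀ α, localCone (P : Set (EuclideanSpace ℝ (Fin n))) α ⊆ localCone (Q : Set _) α

/-- The Minkowski combination `(1 - t) P + t Q`. -/
noncomputable def minkowskiComb (P Q : ConvexBody (EuclideanSpace ℝ (Fin n))) (t : ℝ) :
    ConvexBody (EuclideanSpace ℝ (Fin n)) :=
  (1 - t) • P + t • Q

@[simp]
theorem minkowskiComb_zero (P Q : ConvexBody (EuclideanSpace ℝ (Fin n))) :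
    minkowskiComb P Q 0 = P := by
  have : (0 : ℝ) • Q = 0 := ConvexBody.ext (by
    rw [ConvexBody.coe_smul, Set.zero_smul_set Q.nonempty, ConvexBody.coe_zero])
  rw [minkowskiComb, this, sub_zero, one_smul, add_zero]

@[simp]
theorem minkowskiComb_one (P Q : ConvexBody (EuclideanSpace ℝ (Fin n))) :
    minkowskiComb P Q 1 = Q := by
  have : (0 : ℝ) • P = 0 := ConvexBody.ext (by
    rw [ConvexBody.coe_smul, Set.zero_smul_set P.nonempty, ConvexBody.coe_zero])
  rw [minkowskiComb, sub_self, this, one_smul, zero_add]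

theorem localCone_minkowskiComb (P Q : ConvexBody (EuclideanSpace ℝ (Fin n))) {t : ℝ}
    (h0 : 0 < t) (h1 : t < 1) (α : EuclideanSpace ℝ (Fin n)) :
    localCone (minkowskiComb P Q t : Set _) α =
      localCone (P : Set _) α ∩ localCone (Q : Set _) α := by
  rw [minkowskiComb, localCone_add, localCone_smul _ (sub_pos.mpr h1), localCone_smul _ h0]

/-- This keeps `Z` related to every point of an interpolation path, as filling triangles requires.
-/
theorem Refines.minkowskiComb {P Q Z : ConvexBody (EuclideanSpace ℝ (Fin n))}
    (hP : Refines Z P) (hQ : Refines Z Q) (t : unitInterval) :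
    Refines Z (minkowskiComb P Q t) := by
  rcases t.2.1.eq_or_lt with h0 | h0
  · rwa [← h0, minkowskiComb_zero]
  rcases t.2.2.eq_or_lt with h1 | h1
  · rwa [h1, minkowskiComb_one]
  intro α
  rw [localCone_minkowskiComb P Q h0 h1]
  exact Set.subset_inter (hP α) (hQ α)

/-- For `0 < t < 1` the cones are the intersections of those of `P` and `Q`, hence those of `P`. -/
theorem IsDelzant.minkowskiComb {P Q : ConvexBody (EuclideanSpace ℝ (Fin n))}
    (hP : IsDelzant P) (hQ : IsDelzant Q) (h : Refines P Q) (t : unitInterval) :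
    IsDelzant (minkowskiComb P Q t) := by
  rcases t.2.1.eq_or_lt with h0 | h0
  · rwa [← h0, minkowskiComb_zero]
  rcases t.2.2.eq_or_lt with h1 | h1
  · rwa [h1, minkowskiComb_one]
  rw [isDelzant_iff] at hP hQ ⊢
  have e : ∀ α, localCone (DelzantModuli.minkowskiComb P Q t : Set (EuclideanSpace ℝ (Fin n))) α =
      localCone (P : Set (EuclideanSpace ℝ (Fin n))) α :=
    fun α => by rw [localCone_minkowskiComb P Q h0 h1, Set.inter_eq_left.mpr (h α)]
  refine ⟨(hP.1.smul _).add (hQ.1.smul _), ?_, fun α => ?_⟩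
  · rw [e]; exact hP.2.1
  · rw [e]; exact hP.2.2 α

theorem mem_coneOf_self {m : ℕ} (v : Fin m → EuclideanSpace ℝ (Fin n)) (i : Fin m) :
    v i ∈ coneOf v := by
  refine ⟨Pi.single i 1, fun j => ?_, ?_⟩
  · by_cases h : j = i
    · subst h; simp
    · simp [h]
  · simp [Pi.single_apply]

/-- The vector `α` is in the relative interior of `localCone P α`. -/
theorem IsPolytope.pos_of_localCone_eq {P : ConvexBody (EuclideanSpace ℝ (Fin n))}
    (hP : IsPolytope P) {m : ℕ} {v : Fin m → EuclideanSpace ℝ (Fin n)}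
    (hv : LinearIndependent ℝ v) {α : EuclideanSpace ℝ (Fin n)}
    (hC : localCone (P : Set _) α = coneOf v) {a : Fin m → ℝ} (ha : α = ∑ i, a i • v i)
    (i : Fin m) : 0 < a i := by
  have hvi : v i ∈ localCone (P : Set _) α := hC ▸ mem_coneOf_self v i
  rw [mem_localCone] at hvi
  -- `v i` is constant on the face of `α`, so `α - ε • v i` stays in the cone; its `i`-th
  -- coefficient `a i - ε` is therefore nonnegative.
  obtain ⟨ε, hε, h⟩ := hP.exists_add_smul_mem_localCone (α := α) (β := -v i)
    (fun p hp q hq => by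
      rw [inner_neg_left, inner_neg_left,
        le_antisymm (hvi q hq.1 hq.2 p hp.1) (hvi p hp.1 hp.2 q hq.1)])
  rw [hC] at h
  obtain ⟨b, hb, hbα⟩ := h
  have e : ∑ j, (b j - a j + (Pi.single i ε : Fin m → ℝ) j) • v j = 0 := by
    simp only [add_smul, sub_smul, Finset.sum_add_distrib, Finset.sum_sub_distrib, ← hbα, ← ha]
    simp [Pi.single_apply]
  have := Fintype.linearIndependent_iff.mp hv _ e i
  rw [Pi.single_eq_same] at this
  linarith [hb i]

end DelzantModuli

namespace DelzantModuli

open Filter Pointwise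
open scoped RealInnerProductSpace

theorem inner_plane (x y : EuclideanSpace ℝ (Fin 2)) : ⟪x, y⟫ = x 0 * y 0 + x 1 * y 1 := by
  rw [PiLp.inner_apply, Fin.sum_univ_two]
  simp [mul_comm]

theorem ext_plane {x y : EuclideanSpace ℝ (Fin 2)} (h0 : x 0 = y 0) (h1 : x 1 = y 1) : x = y := by
  ext i
  fin_cases i
  · exact h0
  · exact h1

/-! ### Unimodular cones in the plane -/

/-- The vector of the plane with given integer coordinates. -/
noncomputable def intVec (a b : ℤ) : EuclideanSpace ℝ (Fin 2) := !₂[(a : ℝ), (b : ℝ)]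

@[simp] theorem intVec_zero (a b : ℤ) : intVec a b 0 = a := rfl

@[simp] theorem intVec_one (a b : ℤ) : intVec a b 1 = b := rfl

theorem isPrimitive_intVec {a₀ a₁ b₀ b₁ : ℤ} (h : a₀ * b₁ - a₁ * b₀ = 1) :
    IsPrimitive (intVec a₀ a₁) := by
  refine ⟨![a₀, a₁], fun i => by fin_cases i <;> simp, ?_⟩
  rw [← Finset.normalize_gcd, normalize_eq_one]
  refine isUnit_of_dvd_one ?_
  rw [← h]
  have h0 := Finset.gcd_dvd (f := ![a₀, a₁]) (Finset.mem_univ (0 : Fin 2))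
  have h1 := Finset.gcd_dvd (f := ![a₀, a₁]) (Finset.mem_univ (1 : Fin 2))
  exact dvd_sub (Dvd.dvd.mul_right h0 _) (Dvd.dvd.mul_right h1 _)

theorem coneMultiplicity_eq_one_iff {n m : ℕ} {v : Fin m → EuclideanSpace ℝ (Fin n)} :
    coneMultiplicity v = 1 ↔ ∀ x ∈ Submodule.span ℝ (coneOf v), x ∈ integerLattice n →
      x ∈ AddSubgroup.closure (Set.range v) := by
  rw [coneMultiplicity, AddSubgroup.relIndex_eq_one]
  exact ⟨fun h x hx hx' => h ⟨hx, hx'⟩, fun h x hx => h x hx.1 hx.2⟩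

theorem span_coneOf {n m : ℕ} (v : Fin m → EuclideanSpace ℝ (Fin n)) :
    Submodule.span ℝ (coneOf v) = Submodule.span ℝ (Set.range v) := by
  refine le_antisymm (Submodule.span_le.mpr ?_) (Submodule.span_mono ?_)
  · rintro _ ⟨a, -, rfl⟩
    exact Submodule.sum_mem _ fun i _ =>
      Submodule.smul_mem _ _ (Submodule.subset_span ⟨i, rfl⟩)
  · rintro _ ⟨i, rfl⟩
    exact mem_coneOf_self v i

theorem isUnimodularCone_zero {n : ℕ} : IsUnimodularCone ({0} : Set (EuclideanSpace ℝ (Fin n))) := by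
  refine ⟨0, Fin.elim0, fun i => i.elim0, linearIndependent_empty_type, ?_, ?_⟩
  · ext x
    simp [coneOf]
  · rw [coneMultiplicity_eq_one_iff, span_coneOf]
    intro x hx _
    simp at hx
    simp [hx]

/-- The second vector only certifies primitivity: the determinant against it recovers the
coefficient of a lattice point on the ray as an integer. -/
theorem isUnimodularCone_ray {a₀ a₁ b₀ b₁ : ℤ} (h : a₀ * b₁ - a₁ * b₀ = 1) :
    IsUnimodularCone {β | ∃ c : ℝ, 0 ≤ c ∧ β = c • intVec a₀ a₁} := by
  have hR : (a₀ : ℝ) * b₁ - a₁ * b₀ = 1 := by exact_mod_cast h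
  refine ⟨1, fun _ => intVec a₀ a₁, fun _ => isPrimitive_intVec h, ?_, ?_, ?_⟩
  · rw [Fintype.linearIndependent_iff]
    intro g hg i
    rw [Fin.sum_univ_one] at hg
    have e0 := congrArg (fun x : EuclideanSpace ℝ (Fin 2) => x 0) hg
    have e1 := congrArg (fun x : EuclideanSpace ℝ (Fin 2) => x 1) hg
    simp only [PiLp.smul_apply, intVec_zero, intVec_one, smul_eq_mul, PiLp.zero_apply] at e0 e1
    rw [Subsingleton.elim i 0]
    linear_combination b₁ * e0 - b₀ * e1 - g 0 * hR
  · ext β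
    constructor
    · rintro ⟨c, hc, rfl⟩
      exact ⟨fun _ => c, fun _ => hc, by simp⟩
    · rintro ⟨c, hc, rfl⟩
      exact ⟨c 0, hc 0, by simp⟩
  · rw [coneMultiplicity_eq_one_iff, span_coneOf, Set.range_const]
    intro x hx hx'
    obtain ⟨k, rfl⟩ := Submodule.mem_span_singleton.mp hx
    obtain ⟨x₀, h₀⟩ := hx' 0
    obtain ⟨x₁, h₁⟩ := hx' 1
    simp only [PiLp.smul_apply, intVec_zero, intVec_one, smul_eq_mul] at h₀ h₁
    have hk : k = ((x₀ * b₁ - x₁ * b₀ : ℤ) : ℝ) := by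
      push_cast
      rw [← h₀, ← h₁]
      linear_combination -k * hR
    rw [hk, Int.cast_smul_eq_zsmul ℝ]
    exact AddSubgroup.zsmul_mem _ (AddSubgroup.subset_closure (Set.mem_singleton _)) _

theorem isUnimodularCone_basis {a₀ a₁ b₀ b₁ : ℤ} (h : a₀ * b₁ - a₁ * b₀ = 1) :
    IsUnimodularCone {β | ∃ c d : ℝ, 0 ≤ c ∧ 0 ≤ d ∧
      β = c • intVec a₀ a₁ + d • intVec b₀ b₁} := by
  have hR : (a₀ : ℝ) * b₁ - a₁ * b₀ = 1 := by exact_mod_cast h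
  refine ⟨2, ![intVec a₀ a₁, intVec b₀ b₁], ?_, ?_, ?_, ?_⟩
  · intro i
    fin_cases i
    · exact isPrimitive_intVec h
    · exact isPrimitive_intVec (b₀ := -a₀) (b₁ := -a₁) (by linarith)
  · rw [LinearIndependent.pair_iff]
    intro s t h0
    have e0 := congrArg (fun x : EuclideanSpace ℝ (Fin 2) => x 0) h0
    have e1 := congrArg (fun x : EuclideanSpace ℝ (Fin 2) => x 1) h0
    simp only [PiLp.add_apply, PiLp.smul_apply, intVec_zero, intVec_one, smul_eq_mul,
      PiLp.zero_apply] at e0 e1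
    constructor
    · linear_combination b₁ * e0 - b₀ * e1 - s * hR
    · linear_combination a₀ * e1 - a₁ * e0 - t * hR
  · ext β
    constructor
    · rintro ⟨c, d, hc, hd, rfl⟩
      refine ⟨![c, d], fun i => ?_, by simp [Fin.sum_univ_two]⟩
      fin_cases i
      · exact hc
      · exact hd
    · rintro ⟨c, hc, rfl⟩
      exact ⟨c 0, c 1, hc 0, hc 1, by simp [Fin.sum_univ_two]⟩
  · rw [coneMultiplicity_eq_one_iff]
    intro x _ hx'
    obtain ⟨x₀, h₀⟩ := hx' 0
    obtain ⟨x₁, h₁⟩ := hx' 1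
    have hx : x = (x₀ * b₁ - x₁ * b₀ : ℤ) • intVec a₀ a₁ + (a₀ * x₁ - a₁ * x₀ : ℤ) • intVec b₀ b₁ := by
      rw [← Int.cast_smul_eq_zsmul ℝ, ← Int.cast_smul_eq_zsmul ℝ]
      apply ext_plane
      · simp only [h₀, PiLp.add_apply, PiLp.smul_apply, intVec_zero, smul_eq_mul]
        push_cast
        linear_combination -(x₀ : ℝ) * hR
      · simp only [h₁, PiLp.add_apply, PiLp.smul_apply, intVec_one, smul_eq_mul]
        push_cast
        linear_combination -(x₁ : ℝ) * hR
    rw [hx]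
    exact AddSubgroup.add_mem _
      (AddSubgroup.zsmul_mem _ (AddSubgroup.subset_closure (Set.mem_range_self (0 : Fin 2))) _)
      (AddSubgroup.zsmul_mem _ (AddSubgroup.subset_closure (Set.mem_range_self (1 : Fin 2))) _)

/-! ### Farey cones -/

theorem abs_add_le_abs_combination {a b s t : ℤ} (h : 0 ≤ a * b) (hs : 1 ≤ s) (ht : 1 ≤ t) :
    |a + b| ≤ |s * a + t * b| := by
  rcases mul_nonneg_iff.mp h with ⟨ha, hb⟩ | ⟨ha, hb⟩
  · rw [abs_of_nonneg (by linarith), abs_of_nonneg (by positivity)]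
    nlinarith
  · rw [abs_of_nonpos (by linarith), abs_of_nonpos (by nlinarith)]
    nlinarith

theorem abs_add_of_mul_nonneg {a b : ℤ} (h : 0 ≤ a * b) : |a + b| = |a| + |b| := by
  rcases mul_nonneg_iff.mp h with ⟨ha, hb⟩ | ⟨ha, hb⟩
  · rw [abs_of_nonneg ha, abs_of_nonneg hb, abs_of_nonneg (by linarith)]
  · rw [abs_of_nonpos ha, abs_of_nonpos hb, abs_of_nonpos (by linarith)]; ring

/-- The vector `(α₀, α₁)` lies in the cone of two consecutive Farey vectors of order `N`, or on a
ray through a Farey vector. -/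
def InFareyCone (N : ℤ) (α₀ α₁ : ℝ) : Prop :=
  ∃ a₀ a₁ b₀ b₁ : ℤ, a₀ * b₁ - a₁ * b₀ = 1 ∧ (|a₀| ≤ N ∧ |a₁| ≤ N ∧ |b₀| ≤ N ∧ |b₁| ≤ N) ∧
    0 ≤ a₀ * b₀ ∧ 0 ≤ a₁ * b₁ ∧ ∃ x y : ℝ, 0 ≤ x ∧ 0 ≤ y ∧ α₀ = x * a₀ + y * b₀ ∧
      α₁ = x * a₁ + y * b₁ ∧ (x = 0 ∨ y = 0 ∨ N < |a₀ + b₀| ∨ N < |a₁ + b₁|)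

/-- Subdivide the cone at the mediant `a + b` as long as the mediant stays in the box. As `a` and
`b` lie in a common closed quadrant, each subdivision increases the sum of the absolute values by at
least one, while this sum never exceeds `4 * N`; `k` bounds the remaining steps. -/
theorem inFareyCone_of_basis (N : ℤ) (α₀ α₁ : ℝ) (k : ℕ) : ∀ (a₀ a₁ b₀ b₁ : ℤ),
    a₀ * b₁ - a₁ * b₀ = 1 → |a₀| ≤ N → |a₁| ≤ N → |b₀| ≤ N → |b₁| ≤ N → 0 ≤ a₀ * b₀ →
    0 ≤ a₁ * b₁ → ∀ x y : ℝ, 0 ≤ x → 0 ≤ y → α₀ = x * a₀ + y * b₀ → α₁ = x * a₁ + y * b₁ →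
    4 * N < |a₀| + |a₁| + |b₀| + |b₁| + k → InFareyCone N α₀ α₁ := by
  induction k with
  | zero =>
    intro a₀ a₁ b₀ b₁ _ h1 h2 h3 h4 _ _ x y _ _ _ _ hk
    push_cast at hk
    linarith
  | succ k ih =>
    intro a₀ a₁ b₀ b₁ hd h1 h2 h3 h4 h5 h6 x y hx hy e0 e1 hk
    by_cases hterm : x = 0 ∨ y = 0 ∨ N < |a₀ + b₀| ∨ N < |a₁ + b₁|
    · exact ⟨a₀, a₁, b₀, b₁, hd, ⟨h1, h2, h3, h4⟩, h5, h6, x, y, hx, hy, e0, e1, hterm⟩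
    push Not at hterm
    obtain ⟨-, -, hs0, hs1⟩ := hterm
    have ea := abs_add_of_mul_nonneg h5
    have eb := abs_add_of_mul_nonneg h6
    have ha : 1 ≤ |a₀| + |a₁| := by
      by_contra hlt
      have h0 : a₀ = 0 := abs_eq_zero.mp (by linarith [abs_nonneg a₀, abs_nonneg a₁])
      have h0' : a₁ = 0 := abs_eq_zero.mp (by linarith [abs_nonneg a₀, abs_nonneg a₁])
      simp [h0, h0'] at hd
    have hb : 1 ≤ |b₀| + |b₁| := by
      by_contra hlt
      have h0 : b₀ = 0 := abs_eq_zero.mp (by linarith [abs_nonneg b₀, abs_nonneg b₁])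
      have h0' : b₁ = 0 := abs_eq_zero.mp (by linarith [abs_nonneg b₀, abs_nonneg b₁])
      simp [h0, h0'] at hd
    push_cast at hk
    -- From `x a + y b = (x - y) a + y (a + b) = x (a + b) + (y - x) b`, the smaller coefficient
    -- decides the half containing the vector.
    rcases le_total y x with hxy | hxy
    · refine ih a₀ a₁ (a₀ + b₀) (a₁ + b₁) (by linarith) h1 h2 hs0 hs1
        (by nlinarith [mul_self_nonneg a₀]) (by nlinarith [mul_self_nonneg a₁])
        (x - y) y (by linarith) hy ?_ ?_ ?_
      · push_cast; linarith
      · push_cast; linarith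
      · linarith
    · refine ih (a₀ + b₀) (a₁ + b₁) b₀ b₁ (by linarith) hs0 hs1 h3 h4
        (by nlinarith [mul_self_nonneg b₀]) (by nlinarith [mul_self_nonneg b₁])
        x (y - x) hx (by linarith) ?_ ?_ ?_
      · push_cast; linarith
      · push_cast; linarith
      · linarith

theorem inFareyCone {N : ℤ} (hN : 1 ≤ N) (α₀ α₁ : ℝ) : InFareyCone N α₀ α₁ := by
  have h0 : (0 : ℤ) ≤ N := by linarith
  obtain ⟨k, hk⟩ : ∃ k : ℕ, (k : ℤ) = 4 * N := ⟨(4 * N).toNat, by simp [h0]⟩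
  rcases le_total 0 α₀ with hα₀ | hα₀ <;> rcases le_total 0 α₁ with hα₁ | hα₁
  · exact inFareyCone_of_basis N α₀ α₁ k 1 0 0 1 (by simp) (by simpa) (by simpa) (by simpa)
      (by simpa) (by simp) (by simp) α₀ α₁ hα₀ hα₁ (by simp) (by simp) (by simp [hk])
  · exact inFareyCone_of_basis N α₀ α₁ k 0 (-1) 1 0 (by simp) (by simpa) (by simpa) (by simpa)
      (by simpa) (by simp) (by simp) (-α₁) α₀ (by linarith) hα₀ (by simp) (by simp) (by simp [hk])
  · exact inFareyCone_of_basis N α₀ α₁ k 0 1 (-1) 0 (by simp) (by simpa) (by simpa) (by simpa)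
      (by simpa) (by simp) (by simp) α₁ (-α₀) hα₁ (by linarith) (by simp) (by simp) (by simp [hk])
  · exact inFareyCone_of_basis N α₀ α₁ k (-1) 0 0 (-1) (by simp) (by simpa) (by simpa) (by simpa)
      (by simpa) (by simp) (by simp) (-α₀) (-α₁) (by linarith) (by linarith) (by simp) (by simp)
      (by simp [hk])

/-- No vector of the box of size `N` separates two consecutive Farey vectors of order `N`. -/
theorem not_separates_of_consecutive {N a₀ a₁ b₀ b₁ e₀ e₁ : ℤ} (hd : a₀ * b₁ - a₁ * b₀ = 1)
    (h0 : 0 ≤ a₀ * b₀) (h1 : 0 ≤ a₁ * b₁) (hN : N < |a₀ + b₀| ∨ N < |a₁ + b₁|)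
    (he₀ : |e₀| ≤ N) (he₁ : |e₁| ≤ N) (ha : a₀ * e₀ + a₁ * e₁ < 0) :
    b₀ * e₀ + b₁ * e₁ ≤ 0 := by
  by_contra! hb
  -- If `e` separated `a` and `b`, its rotation `(e₁, -e₀)` would be `s a + t b` with integers `s, t
  -- ≥ 1`. Its coordinates would then be at least those of the mediant in absolute value, pushing it
  -- out of the box.
  have c0 : (b₀ * e₀ + b₁ * e₁) * a₀ + -(a₀ * e₀ + a₁ * e₁) * b₀ = e₁ := by
    linear_combination e₁ * hd
  have c1 : (b₀ * e₀ + b₁ * e₁) * a₁ + -(a₀ * e₀ + a₁ * e₁) * b₁ = -e₀ := by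
    linear_combination -e₀ * hd
  have i0 := abs_add_le_abs_combination h0 (s := b₀ * e₀ + b₁ * e₁)
    (t := -(a₀ * e₀ + a₁ * e₁)) (by linarith) (by linarith)
  have i1 := abs_add_le_abs_combination h1 (s := b₀ * e₀ + b₁ * e₁)
    (t := -(a₀ * e₀ + a₁ * e₁)) (by linarith) (by linarith)
  rw [c0] at i0
  rw [c1, abs_neg] at i1
  rcases hN with h | h <;> linarith

/-- A vector of the box nonnegative on the interior of a Farey cone is nonnegative on the cone. -/
theorem nonneg_of_consecutive {N a₀ a₁ b₀ b₁ e₀ e₁ : ℤ} (hd : a₀ * b₁ - a₁ * b₀ = 1)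
    (h0 : 0 ≤ a₀ * b₀) (h1 : 0 ≤ a₁ * b₁) (hN : N < |a₀ + b₀| ∨ N < |a₁ + b₁|)
    (he₀ : |e₀| ≤ N) (he₁ : |e₁| ≤ N) {x y : ℝ} (hx : 0 < x) (hy : 0 < y)
    (h : 0 ≤ x * (a₀ * e₀ + a₁ * e₁ : ℤ) + y * (b₀ * e₀ + b₁ * e₁ : ℤ)) :
    0 ≤ a₀ * e₀ + a₁ * e₁ ∧ 0 ≤ b₀ * e₀ + b₁ * e₁ := by
  constructor
  · by_contra! ha
    have hb : ((b₀ * e₀ + b₁ * e₁ : ℤ) : ℝ) ≤ 0 := by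
      exact_mod_cast not_separates_of_consecutive hd h0 h1 hN he₀ he₁ ha
    have ha' : ((a₀ * e₀ + a₁ * e₁ : ℤ) : ℝ) < 0 := by exact_mod_cast ha
    nlinarith [mul_pos_of_neg_of_neg ha' (neg_lt_zero.mpr hx)]
  · by_contra! hb
    have ha : a₀ * e₀ + a₁ * e₁ ≤ 0 := by
      by_contra! hpos
      have := not_separates_of_consecutive (e₀ := -e₀) (e₁ := -e₁) hd h0 h1 hN (by simpa)
        (by simpa) (by linarith)
      linarith
    have ha' : ((a₀ * e₀ + a₁ * e₁ : ℤ) : ℝ) ≤ 0 := by exact_mod_cast ha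
    have hb' : ((b₀ * e₀ + b₁ * e₁ : ℤ) : ℝ) < 0 := by exact_mod_cast hb
    nlinarith [mul_pos_of_neg_of_neg hb' (neg_lt_zero.mpr hy)]

end DelzantModuli

namespace DelzantModuli

open Filter Pointwise
open scoped RealInnerProductSpace

/-! ### Farey zonotopes -/

/-- The segment `[0, e]`. -/
noncomputable def segmentBody {n : ℕ} (e : EuclideanSpace ℝ (Fin n)) :
    ConvexBody (EuclideanSpace ℝ (Fin n)) where
  carrier := convexHull ℝ (({0, e} : Finset (EuclideanSpace ℝ (Fin n))) : Set _)
  convex' := convex_convexHull ℝ _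
  isCompact' := (Finset.finite_toSet _).isCompact_convexHull (𝕜 := ℝ)
  nonempty' := ⟨0, subset_convexHull ℝ _ (by simp)⟩

theorem coe_segmentBody {n : ℕ} (e : EuclideanSpace ℝ (Fin n)) :
    (segmentBody e : Set (EuclideanSpace ℝ (Fin n))) =
      convexHull ℝ (({0, e} : Finset (EuclideanSpace ℝ (Fin n))) : Set _) := rfl

theorem isPolytope_segmentBody {n : ℕ} (e : EuclideanSpace ℝ (Fin n)) :
    IsPolytope (segmentBody e) :=
  ⟨_, coe_segmentBody e⟩

theorem forall_inner_le_segmentBody {n : ℕ} {e γ : EuclideanSpace ℝ (Fin n)} {c : ℝ} :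
    (∀ x ∈ segmentBody e, ⟪γ, x⟫ ≤ c) ↔ 0 ≤ c ∧ ⟪γ, e⟫ ≤ c := by
  constructor
  · intro h
    have h0 := h 0 (subset_convexHull ℝ _ (by simp))
    exact ⟨by simpa using h0, h e (subset_convexHull ℝ _ (by simp))⟩
  · rintro ⟨h0, h1⟩ x hx
    refine inner_le_of_mem_convexHull (fun s hs => ?_) hx
    rw [Finset.mem_coe, Finset.mem_insert, Finset.mem_singleton] at hs
    rcases hs with rfl | rfl
    · simpa using h0
    · exact h1

theorem mem_localCone_segmentBody {n : ℕ} {e α β : EuclideanSpace ℝ (Fin n)} :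
    β ∈ localCone (segmentBody e : Set (EuclideanSpace ℝ (Fin n))) α ↔
      (0 ≤ ⟪α, e⟫ → 0 ≤ ⟪β, e⟫) ∧ (⟪α, e⟫ ≤ 0 → ⟪β, e⟫ ≤ 0) := by
  rw [mem_localCone_iff_of_convexHull (coe_segmentBody e)]
  simp only [forall_inner_le_segmentBody, Finset.mem_insert, Finset.mem_singleton,
    forall_eq_or_imp, forall_eq, inner_zero_right, le_refl, true_and, and_true]
  tauto

/-- The Minkowski sum of the segments from `0` to all integer vectors of the box of size `N`. -/
noncomputable def fareyZonotope (N : ℕ) : ConvexBody (EuclideanSpace ℝ (Fin 2)) :=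
  ∑ e ∈ Finset.Icc (-N : ℤ) N ×ˢ Finset.Icc (-N : ℤ) N, segmentBody (intVec e.1 e.2)

/-- The fan is cut out by the lines orthogonal to the box vectors. One inequality per vector is
enough since the box is symmetric. -/
theorem mem_localCone_fareyZonotope {N : ℕ} {α β : EuclideanSpace ℝ (Fin 2)} :
    β ∈ localCone (fareyZonotope N : Set (EuclideanSpace ℝ (Fin 2))) α ↔
      ∀ e₀ e₁ : ℤ, |e₀| ≤ N → |e₁| ≤ N → 0 ≤ α 0 * e₀ + α 1 * e₁ → 0 ≤ β 0 * e₀ + β 1 * e₁ := by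
  simp only [fareyZonotope, localCone_sum, Set.mem_iInter, mem_localCone_segmentBody,
    Finset.mem_product, Finset.mem_Icc, Prod.forall, inner_plane, intVec_zero, intVec_one, abs_le]
  constructor
  · intro h e₀ e₁ h0 h1
    exact (h e₀ e₁ ⟨h0, h1⟩).1
  · intro h e₀ e₁ he
    refine ⟨h e₀ e₁ he.1 he.2, fun h' => ?_⟩
    have := h (-e₀) (-e₁) ⟨by linarith [he.1.2], by linarith [he.1.1]⟩
      ⟨by linarith [he.2.2], by linarith [he.2.1]⟩ (by push_cast; linarith)
    push_cast at this
    linarith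

/-- The cone is the face, containing `α` in its relative interior, of the Farey cone of `a` and `b`.
The box vectors `(b₁, -b₀)` and `(-a₁, a₀)` bound it by Cramer's rule, and no other box vector cuts
it further. -/
theorem isUnimodularCone_localCone_fareyZonotope {N : ℕ} (hN : 1 ≤ N)
    (α : EuclideanSpace ℝ (Fin 2)) :
    IsUnimodularCone (localCone (fareyZonotope N : Set (EuclideanSpace ℝ (Fin 2))) α) := by
  have hN' : (1 : ℤ) ≤ N := by exact_mod_cast hN
  obtain ⟨a₀, a₁, b₀, b₁, hd, ⟨ha₀, ha₁, hb₀, hb₁⟩, h0, h1, x, y, hx, hy, e0, e1, hxy⟩ :=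
    inFareyCone hN' (α 0) (α 1)
  have hR : (a₀ : ℝ) * b₁ - a₁ * b₀ = 1 := by exact_mod_cast hd
  have cramer : ∀ β : EuclideanSpace ℝ (Fin 2), β = (β 0 * b₁ - β 1 * b₀) • intVec a₀ a₁ +
      (β 1 * a₀ - β 0 * a₁) • intVec b₀ b₁ := by
    intro β
    apply ext_plane
    · simp only [PiLp.add_apply, PiLp.smul_apply, intVec_zero, smul_eq_mul]
      linear_combination -β 0 * hR
    · simp only [PiLp.add_apply, PiLp.smul_apply, intVec_one, smul_eq_mul]
      linear_combination -β 1 * hR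
  have c0 : α 0 * b₁ - α 1 * b₀ = x := by rw [e0, e1]; linear_combination x * hR
  have c1 : α 1 * a₀ - α 0 * a₁ = y := by rw [e0, e1]; linear_combination y * hR
  have na₀ : |-a₀| ≤ (N : ℤ) := by rwa [abs_neg]
  have na₁ : |-a₁| ≤ (N : ℤ) := by rwa [abs_neg]
  have nb₀ : |-b₀| ≤ (N : ℤ) := by rwa [abs_neg]
  have nb₁ : |-b₁| ≤ (N : ℤ) := by rwa [abs_neg]
  -- the two inequalities cutting out the cone of `a` and `b`
  have hβ0 : ∀ {β}, β ∈ localCone (fareyZonotope N : Set (EuclideanSpace ℝ (Fin 2))) α →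
      0 ≤ β 0 * b₁ - β 1 * b₀ := fun {β} hβ => by
    have := mem_localCone_fareyZonotope.mp hβ b₁ (-b₀) hb₁ nb₀ (by push_cast; linarith)
    push_cast at this; linarith
  have hβ1 : ∀ {β}, β ∈ localCone (fareyZonotope N : Set (EuclideanSpace ℝ (Fin 2))) α →
      0 ≤ β 1 * a₀ - β 0 * a₁ := fun {β} hβ => by
    have := mem_localCone_fareyZonotope.mp hβ (-a₁) a₀ na₁ ha₀ (by push_cast; linarith)
    push_cast at this; linarith
  have hβ0' : x = 0 → ∀ {β}, β ∈ localCone (fareyZonotope N : Set (EuclideanSpace ℝ (Fin 2))) α →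
      β 0 * b₁ - β 1 * b₀ = 0 := fun hx0 {β} hβ => by
    have := mem_localCone_fareyZonotope.mp hβ (-b₁) b₀ nb₁ hb₀ (by push_cast; linarith)
    push_cast at this
    exact le_antisymm (by linarith) (hβ0 hβ)
  have hβ1' : y = 0 → ∀ {β}, β ∈ localCone (fareyZonotope N : Set (EuclideanSpace ℝ (Fin 2))) α →
      β 1 * a₀ - β 0 * a₁ = 0 := fun hy0 {β} hβ => by
    have := mem_localCone_fareyZonotope.mp hβ a₁ (-a₀) ha₁ na₀ (by push_cast; linarith)
    push_cast at this
    exact le_antisymm (by linarith) (hβ1 hβ)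
  rcases hx.eq_or_lt with hx0 | hx0 <;> rcases hy.eq_or_lt with hy0 | hy0
  · convert isUnimodularCone_zero (n := 2) using 1
    refine Set.eq_singleton_iff_unique_mem.mpr
      ⟨mem_localCone_fareyZonotope.mpr fun _ _ _ _ _ => by simp, fun β hβ => ?_⟩
    rw [cramer β, hβ0' hx0.symm hβ, hβ1' hy0.symm hβ]
    simp
  · convert isUnimodularCone_ray (a₀ := b₀) (a₁ := b₁) (b₀ := -a₀) (b₁ := -a₁) (by linarith)
      using 1
    ext β
    constructor
    · intro hβ
      refine ⟨_, hβ1 hβ, ?_⟩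
      conv_lhs => rw [cramer β, hβ0' hx0.symm hβ]
      simp
    · rintro ⟨c, hc, rfl⟩
      refine mem_localCone_fareyZonotope.mpr fun f₀ f₁ _ _ hf => ?_
      rw [e0, e1, ← hx0] at hf
      have : 0 ≤ (b₀ : ℝ) * f₀ + b₁ * f₁ := nonneg_of_mul_nonneg_right
        (by linarith : 0 ≤ y * ((b₀ : ℝ) * f₀ + b₁ * f₁)) hy0
      have := mul_nonneg hc this
      simp only [PiLp.smul_apply, intVec_zero, intVec_one, smul_eq_mul]
      linarith
  · convert isUnimodularCone_ray hd using 1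
    ext β
    constructor
    · intro hβ
      refine ⟨_, hβ0 hβ, ?_⟩
      conv_lhs => rw [cramer β, hβ1' hy0.symm hβ]
      simp
    · rintro ⟨c, hc, rfl⟩
      refine mem_localCone_fareyZonotope.mpr fun f₀ f₁ _ _ hf => ?_
      rw [e0, e1, ← hy0] at hf
      have : 0 ≤ (a₀ : ℝ) * f₀ + a₁ * f₁ := nonneg_of_mul_nonneg_right
        (by linarith : 0 ≤ x * ((a₀ : ℝ) * f₀ + a₁ * f₁)) hx0
      have := mul_nonneg hc this
      simp only [PiLp.smul_apply, intVec_zero, intVec_one, smul_eq_mul]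
      linarith
  · have hN2 : (N : ℤ) < |a₀ + b₀| ∨ (N : ℤ) < |a₁ + b₁| := by
      rcases hxy with h | h | h
      · exact absurd h hx0.ne'
      · exact absurd h hy0.ne'
      · exact h
    convert isUnimodularCone_basis hd using 1
    ext β
    constructor
    · intro hβ
      exact ⟨_, _, hβ0 hβ, hβ1 hβ, cramer β⟩
    · rintro ⟨c, d, hc, hd', rfl⟩
      refine mem_localCone_fareyZonotope.mpr fun f₀ f₁ hf₀ hf₁ hf => ?_
      rw [e0, e1] at hf
      obtain ⟨i0, i1⟩ := nonneg_of_consecutive hd h0 h1 hN2 hf₀ hf₁ hx0 hy0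
        (by push_cast; linarith)
      have i0' : 0 ≤ (a₀ : ℝ) * f₀ + a₁ * f₁ := by exact_mod_cast i0
      have i1' : 0 ≤ (b₀ : ℝ) * f₀ + b₁ * f₁ := by exact_mod_cast i1
      simp only [PiLp.add_apply, PiLp.smul_apply, intVec_zero, intVec_one, smul_eq_mul]
      nlinarith [mul_nonneg hc i0', mul_nonneg hd' i1']

theorem isDelzant_fareyZonotope {N : ℕ} (hN : 1 ≤ N) : IsDelzant (fareyZonotope N) := by
  have hN' : (1 : ℤ) ≤ N := by exact_mod_cast hN
  refine isDelzant_iff.mpr ⟨.sum _ fun _ _ => isPolytope_segmentBody _, fun β hβ => ?_,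
    isUnimodularCone_localCone_fareyZonotope hN⟩
  rw [mem_localCone_fareyZonotope] at hβ
  have h1 := hβ 1 0 (by simpa) (by simp) (by simp)
  have h2 := hβ (-1) 0 (by simpa) (by simp) (by simp)
  have h3 := hβ 0 1 (by simp) (by simpa) (by simp)
  have h4 := hβ 0 (-1) (by simp) (by simpa) (by simp)
  simp at h1 h2 h3 h4
  exact ext_plane (le_antisymm h2 h1) (le_antisymm h4 h3)

/-! ### Plane determinants, and the Farey fans as eventual refinements. -/

/-- The determinant of two vectors of the plane. -/
def planeDet (x y : EuclideanSpace ℝ (Fin 2)) : ℝ := x 0 * y 1 - x 1 * y 0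

theorem planeDet_smul_eq (x y z : EuclideanSpace ℝ (Fin 2)) :
    planeDet x y • z = planeDet z y • x + planeDet x z • y := by
  apply ext_plane <;> simp only [planeDet, PiLp.add_apply, PiLp.smul_apply, smul_eq_mul] <;> ring

theorem eq_planeDet_div_smul {x y : EuclideanSpace ℝ (Fin 2)} (h : planeDet x y ≠ 0)
    (z : EuclideanSpace ℝ (Fin 2)) :
    z = (planeDet z y / planeDet x y) • x + (planeDet x z / planeDet x y) • y := by
  have e := congrArg (fun w => (planeDet x y)⁻¹ • w) (planeDet_smul_eq x y z)
  simpa only [inv_smul_smul₀ h, smul_add, smul_smul, ← div_eq_inv_mul] using e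

theorem planeDet_ne_zero_of_linearIndependent {v : Fin 2 → EuclideanSpace ℝ (Fin 2)}
    (hv : LinearIndependent ℝ v) : planeDet (v 0) (v 1) ≠ 0 := by
  intro h
  have key : ∀ z, planeDet z (v 1) = 0 := by
    intro z
    have e := planeDet_smul_eq (v 0) (v 1) z
    rw [h, zero_smul] at e
    have := Fintype.linearIndependent_iff.mp hv ![planeDet z (v 1), planeDet (v 0) z]
      (by rw [Fin.sum_univ_two]; exact e.symm) 0
    exact this
  have h0 := key (intVec 1 0)
  have h1 := key (intVec 0 1)
  simp [planeDet] at h0 h1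
  exact hv.ne_zero 1 (ext_plane h1 h0)

theorem card_le_two_of_linearIndependent {m : ℕ} {v : Fin m → EuclideanSpace ℝ (Fin 2)}
    (hv : LinearIndependent ℝ v) : m ≤ 2 := by
  simpa using hv.fintype_card_le_finrank

/-- A cone generated by independent vectors of the box of size `N` contains every cone of the
Farey fan of order `N` whose relative interior it meets. -/
theorem localCone_fareyZonotope_subset_coneOf {N : ℕ} (hN : 1 ≤ N) {m : ℕ}
    {v : Fin m → EuclideanSpace ℝ (Fin 2)} (hv : LinearIndependent ℝ v) (z : Fin m → Fin 2 → ℤ)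
    (hz : ∀ i k, v i k = z i k) (hzN : ∀ i k, |z i k| ≤ N) {α : EuclideanSpace ℝ (Fin 2)}
    (hα : α ∈ coneOf v) :
    localCone (fareyZonotope N : Set (EuclideanSpace ℝ (Fin 2))) α ⊆ coneOf v := by
  have hN' : (1 : ℤ) ≤ N := by exact_mod_cast hN
  intro β hβ
  rw [mem_localCone_fareyZonotope] at hβ
  obtain ⟨a, ha, rfl⟩ := hα
  have hm := card_le_two_of_linearIndependent hv
  have nz : ∀ i k, |-z i k| ≤ (N : ℤ) := fun i k => by rw [abs_neg]; exact hzN i k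
  interval_cases m
  · have h1 := hβ 1 0 (by simpa) (by simp) (by simp)
    have h2 := hβ (-1) 0 (by simpa) (by simp) (by simp)
    have h3 := hβ 0 1 (by simp) (by simpa) (by simp)
    have h4 := hβ 0 (-1) (by simp) (by simpa) (by simp)
    simp at h1 h2 h3 h4
    have : β = 0 := ext_plane (le_antisymm h2 h1) (le_antisymm h4 h3)
    exact ⟨a, ha, by simp [this]⟩
  · simp only [Fin.sum_univ_one, PiLp.smul_apply, smul_eq_mul] at hβ
    -- Rotations of `v 0` in both directions force `β` to be parallel to `v 0`; testing with `v 0`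
    -- itself gives the sign.
    have h1 := hβ (-z 0 1) (z 0 0) (nz 0 1) (hzN 0 0) (by push_cast; rw [← hz, ← hz]; linarith)
    have h2 := hβ (z 0 1) (-z 0 0) (hzN 0 1) (nz 0 0) (by push_cast; rw [← hz, ← hz]; linarith)
    have h3 := hβ (z 0 0) (z 0 1) (hzN 0 0) (hzN 0 1) (by
      rw [← hz, ← hz]
      nlinarith [mul_nonneg (ha 0) (mul_self_nonneg (v 0 0)),
        mul_nonneg (ha 0) (mul_self_nonneg (v 0 1))])
    push_cast at h1 h2
    rw [← hz, ← hz] at h1 h2 h3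
    have hdet : β 1 * v 0 0 = β 0 * v 0 1 := by linarith
    have hs : 0 < v 0 0 ^ 2 + v 0 1 ^ 2 := by
      rcases (by positivity : 0 ≤ v 0 0 ^ 2 + v 0 1 ^ 2).eq_or_lt with h | h
      · refine absurd (ext_plane ?_ ?_ : v 0 = 0) (hv.ne_zero 0)
        · exact pow_eq_zero_iff two_ne_zero |>.mp (by nlinarith [sq_nonneg (v 0 0), sq_nonneg (v 0 1)])
        · exact pow_eq_zero_iff two_ne_zero |>.mp (by nlinarith [sq_nonneg (v 0 0), sq_nonneg (v 0 1)])
      · exact h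
    refine ⟨fun _ => (β 0 * v 0 0 + β 1 * v 0 1) / (v 0 0 ^ 2 + v 0 1 ^ 2), fun _ => by positivity,
      ext_plane ?_ ?_⟩
    · simp only [Fin.sum_univ_one, PiLp.smul_apply, smul_eq_mul]
      rw [div_mul_eq_mul_div, eq_div_iff hs.ne']
      linear_combination -v 0 1 * hdet
    · simp only [Fin.sum_univ_one, PiLp.smul_apply, smul_eq_mul]
      rw [div_mul_eq_mul_div, eq_div_iff hs.ne']
      linear_combination v 0 0 * hdet
  · have hD := planeDet_ne_zero_of_linearIndependent hv
    simp only [Fin.sum_univ_two, PiLp.add_apply, PiLp.smul_apply, smul_eq_mul] at hβ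
    -- The numerator of each Cramer coefficient is, up to sign, the pairing with a rotated
    -- generator, a box vector, so it inherits the sign it has at `α`.
    have i0 : 0 ≤ planeDet β (v 1) / planeDet (v 0) (v 1) := by
      rcases hD.lt_or_gt with h | h
      · refine div_nonneg_of_nonpos ?_ h.le
        have := hβ (-z 1 1) (z 1 0) (nz 1 1) (hzN 1 0) (by
          push_cast; rw [← hz, ← hz]
          have := mul_nonneg_of_nonpos_of_nonpos h.le (neg_nonpos.mpr (ha 0))
          rw [planeDet] at this
          linarith)
        push_cast at this; rw [← hz, ← hz] at this
        rw [planeDet]; linarith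
      · refine div_nonneg ?_ h.le
        have := hβ (z 1 1) (-z 1 0) (hzN 1 1) (nz 1 0) (by
          push_cast; rw [← hz, ← hz]
          have := mul_nonneg (ha 0) h.le
          rw [planeDet] at this
          linarith)
        push_cast at this; rw [← hz, ← hz] at this
        rw [planeDet]; linarith
    have i1 : 0 ≤ planeDet (v 0) β / planeDet (v 0) (v 1) := by
      rcases hD.lt_or_gt with h | h
      · refine div_nonneg_of_nonpos ?_ h.le
        have := hβ (z 0 1) (-z 0 0) (hzN 0 1) (nz 0 0) (by
          push_cast; rw [← hz, ← hz]
          have := mul_nonneg_of_nonpos_of_nonpos h.le (neg_nonpos.mpr (ha 1))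
          rw [planeDet] at this
          linarith)
        push_cast at this; rw [← hz, ← hz] at this
        rw [planeDet]; linarith
      · refine div_nonneg ?_ h.le
        have := hβ (-z 0 1) (z 0 0) (nz 0 1) (hzN 0 0) (by
          push_cast; rw [← hz, ← hz]
          have := mul_nonneg (ha 1) h.le
          rw [planeDet] at this
          linarith)
        push_cast at this; rw [← hz, ← hz] at this
        rw [planeDet]; linarith
    refine ⟨![planeDet β (v 1) / planeDet (v 0) (v 1), planeDet (v 0) β / planeDet (v 0) (v 1)],
      fun i => ?_, ?_⟩
    · fin_cases i
      · exact i0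
      · exact i1
    · rw [Fin.sum_univ_two]
      exact eq_planeDet_div_smul hD β

theorem eventually_refines_fareyZonotope {P : ConvexBody (EuclideanSpace ℝ (Fin 2))}
    (hP : IsDelzant P) : ∀ᶠ N in atTop, Refines (fareyZonotope N) P := by
  have hP' := isDelzant_iff.mp hP
  have key : ∀ C ∈ normalFan (P : Set (EuclideanSpace ℝ (Fin 2))), ∀ᶠ N in atTop,
      ∀ α, α ∈ C → localCone (fareyZonotope N : Set (EuclideanSpace ℝ (Fin 2))) α ⊆ C := by
    intro C hC
    obtain ⟨m, v, hprim, hv, rfl, -⟩ := hP.2.2 C hC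
    choose z hz _ using hprim
    -- The sum of all coordinates puts every generator in the box; the extra `1` ensures `1 ≤ N`.
    filter_upwards [eventually_ge_atTop (1 + ∑ i, ∑ k, (z i k).natAbs)] with N hN α hα
    refine localCone_fareyZonotope_subset_coneOf (by omega) hv z hz (fun i k => ?_) hα
    have h1 := Finset.single_le_sum (f := fun k => (z i k).natAbs) (fun _ _ => Nat.zero_le _)
      (Finset.mem_univ k)
    have h2 := Finset.single_le_sum (f := fun i => ∑ k, (z i k).natAbs) (fun _ _ => Nat.zero_le _)
      (Finset.mem_univ i)
    rw [Int.abs_eq_natAbs]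
    exact_mod_cast h1.trans (h2.trans (by omega))
  have := (finite_normalFan hP'.1).eventually_all.mpr key
  filter_upwards [this] with N hN α
  exact hN _ ⟨α, rfl⟩ α (self_mem_localCone _ α)

end DelzantModuli

namespace DelzantModuli

open Filter Pointwise Topology
open scoped RealInnerProductSpace

/-! ### Normal fans of nearby Delzant polygons -/

section General

variable {n : ℕ}

theorem localCone_subset_of_mem {P : Set (EuclideanSpace ℝ (Fin n))}
    {α β : EuclideanSpace ℝ (Fin n)} (h : β ∈ localCone P α) :
    localCone P β ⊆ localCone P α := by
  intro γ hγ
  rw [mem_localCone] at *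
  exact fun p hp hα => hγ p hp (h p hp hα)

theorem face_smul {P : Set (EuclideanSpace ℝ (Fin n))} {c : ℝ} (hc : 0 < c)
    (α : EuclideanSpace ℝ (Fin n)) : face P (c • α) = face P α := by
  ext p
  simp only [face, Set.mem_ofPred_eq, real_inner_smul_left, mul_le_mul_iff_right₀ hc]

/-- Otherwise `α` would be constant on `Q`, contradicting full dimension. -/
theorem neg_smul_notMem_localCone {Q : ConvexBody (EuclideanSpace ℝ (Fin n))} (hQ : IsDelzant Q)
    {α : EuclideanSpace ℝ (Fin n)} (hα : α ≠ 0) {k : ℝ} (hk : 0 < k) :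
    -(k • α) ∉ localCone (Q : Set (EuclideanSpace ℝ (Fin n))) α := by
  intro h
  rw [mem_localCone] at h
  obtain ⟨p, hp, hmax⟩ := exists_inner_max Q α
  have hconst : ∀ x ∈ Q, ⟪α, x⟫ = ⟪α, p⟫ := by
    intro x hx
    have := h p hp hmax x hx
    rw [inner_neg_left, inner_neg_left, real_inner_smul_left, real_inner_smul_left, neg_le_neg_iff,
      mul_le_mul_iff_right₀ hk] at this
    exact le_antisymm (hmax x hx) this
  refine hα ((isDelzant_iff.mp hQ).2.1 (mem_localCone.mpr fun q hq _ x hx => ?_))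
  rw [hconst x hx, hconst q hq]

/-- On `Q`, both `α` and `β` are maximal at a maximizer of `α`, so a maximizer of the positive
combination maximizes each of them. -/
theorem face_subset_of_add {Q : ConvexBody (EuclideanSpace ℝ (Fin n))}
    {α β : EuclideanSpace ℝ (Fin n)} (hβ : β ∈ localCone (Q : Set (EuclideanSpace ℝ (Fin n))) α)
    {s t : ℝ} (hs : 0 < s) (ht : 0 < t) :
    face (Q : Set (EuclideanSpace ℝ (Fin n))) (s • α + t • β) ⊆ face (Q : Set _) α := by
  rintro q ⟨hq, hmax⟩
  obtain ⟨p, hp, hpα⟩ := exists_inner_max Q α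
  have h1 := hmax p hp
  have h2 := mem_localCone.mp hβ p hp hpα q hq
  simp only [inner_add_left, real_inner_smul_left] at h1
  refine ⟨hq, fun x hx => (hpα x hx).trans ?_⟩
  have h3 := mul_le_mul_of_nonneg_left h2 ht.le
  exact le_of_mul_le_mul_left (by linarith) hs

theorem inner_eq_of_mem_face {P : Set (EuclideanSpace ℝ (Fin n))}
    {α p q : EuclideanSpace ℝ (Fin n)} (hp : p ∈ face P α) (hq : q ∈ face P α) :
    ⟪α, p - q⟫ = 0 := by
  rw [inner_sub_right, sub_eq_zero]
  exact le_antisymm (hq.2 p hp.1) (hp.2 q hq.1)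

theorem exists_int_coeff_of_mem_closure {m : ℕ} {v : Fin m → EuclideanSpace ℝ (Fin n)}
    {x : EuclideanSpace ℝ (Fin n)} (hx : x ∈ AddSubgroup.closure (Set.range v)) :
    ∃ k : Fin m → ℤ, x = ∑ i, (k i : ℝ) • v i := by
  induction hx using AddSubgroup.closure_induction with
  | mem x hx =>
    obtain ⟨i, rfl⟩ := hx
    exact ⟨Pi.single i 1, by simp [Pi.single_apply]⟩
  | zero => exact ⟨0, by simp⟩
  | add x y _ _ hx hy =>
    obtain ⟨k, rfl⟩ := hx
    obtain ⟨l, rfl⟩ := hy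
    exact ⟨k + l, by simp [add_smul, Finset.sum_add_distrib]⟩
  | neg x _ hx =>
    obtain ⟨k, rfl⟩ := hx
    exact ⟨-k, by simp⟩

/-- If the face in direction `γ` is a single point, then `γ` is interior to its cone. -/
theorem IsPolytope.exists_add_smul_mem_of_subsingleton
    {P : ConvexBody (EuclideanSpace ℝ (Fin n))} (hP : IsPolytope P)
    {γ : EuclideanSpace ℝ (Fin n)} (h : ¬(face (P : Set (EuclideanSpace ℝ (Fin n))) γ).Nontrivial)
    (β : EuclideanSpace ℝ (Fin n)) :
    ∃ ε : ℝ, 0 < ε ∧ γ + ε • β ∈ localCone (P : Set (EuclideanSpace ℝ (Fin n))) γ :=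
  hP.exists_add_smul_mem_localCone fun p hp q hq => by
    rw [Set.not_nontrivial_iff.mp h hp hq]

end General

theorem eq_two_of_forall_add_smul_mem_coneOf {m : ℕ} {v : Fin m → EuclideanSpace ℝ (Fin 2)}
    (hv : LinearIndependent ℝ v) {γ : EuclideanSpace ℝ (Fin 2)} (hγ : γ ∈ coneOf v)
    (h : ∀ β, ∃ ε : ℝ, 0 < ε ∧ γ + ε • β ∈ coneOf v) : m = 2 := by
  have hsub : coneOf v ⊆ Submodule.span ℝ (Set.range v) := by
    rw [← span_coneOf]; exact Submodule.subset_span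
  have htop : Submodule.span ℝ (Set.range v) = ⊤ := by
    rw [Submodule.eq_top_iff']
    intro β
    obtain ⟨ε, hε, hmem⟩ := h β
    have := Submodule.sub_mem _ (hsub hmem) (hsub hγ)
    rw [add_sub_cancel_left] at this
    exact (Submodule.smul_mem_iff _ hε.ne').mp this
  have := finrank_span_eq_card hv
  rw [htop, finrank_top, finrank_euclideanSpace_fin, Fintype.card_fin] at this
  exact this.symm

theorem planeDet_eq_zero_of_inner_eq_zero {x y d : EuclideanSpace ℝ (Fin 2)} (hd : d ≠ 0)
    (hx : ⟪x, d⟫ = 0) (hy : ⟪y, d⟫ = 0) : planeDet x y = 0 := by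
  rw [inner_plane] at hx hy
  by_contra h
  rw [planeDet] at h
  refine hd (ext_plane ?_ ?_)
  · refine mul_left_cancel₀ h ?_
    simp only [PiLp.zero_apply]
    linear_combination y 1 * hx - x 1 * hy
  · refine mul_left_cancel₀ h ?_
    simp only [PiLp.zero_apply]
    linear_combination x 0 * hy - y 0 * hx

/-- It converts the variation of `u` along an edge with normal `r` into the determinant of `r` and
`u`, an integer for integer vectors. -/
theorem inner_mul_inner_self_plane (r u d : EuclideanSpace ℝ (Fin 2)) (h : ⟪r, d⟫ = 0) :
    ⟪u, d⟫ * ‖r‖ ^ 2 = planeDet r u * planeDet r d := by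
  rw [← real_inner_self_eq_norm_sq, inner_plane u d, inner_plane r r]
  rw [inner_plane] at h
  simp only [planeDet]
  linear_combination (r 0 * u 0 + r 1 * u 1) * h

theorem exists_dist_lt_of_dist_lt {n : ℕ} {P Q : ConvexBody (EuclideanSpace ℝ (Fin n))} {ε : ℝ}
    (h : dist P Q < ε) {x : EuclideanSpace ℝ (Fin n)} (hx : x ∈ P) : ∃ y ∈ Q, ‖x - y‖ < ε := by
  rw [← ConvexBody.hausdorffDist_coe] at h
  obtain ⟨y, hy, hxy⟩ := Metric.exists_dist_lt_of_hausdorffDist_lt hx h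
    ConvexBody.hausdorffEDist_ne_top
  exact ⟨y, hy, by rwa [← dist_eq_norm]⟩

theorem inner_le_inner_add_of_norm_lt {n : ℕ} (u : EuclideanSpace ℝ (Fin n))
    {x y : EuclideanSpace ℝ (Fin n)} {ε : ℝ} (h : ‖x - y‖ < ε) : ⟪u, x⟫ ≤ ⟪u, y⟫ + ε * ‖u‖ := by
  have h1 := real_inner_le_norm u (x - y)
  rw [inner_sub_right] at h1
  nlinarith [norm_nonneg u]

theorem exists_closedBall_subset {n : ℕ} {P : ConvexBody (EuclideanSpace ℝ (Fin n))}
    (hP : IsDelzant P) : ∃ c : EuclideanSpace ℝ (Fin n), ∃ ρ : ℝ, 0 < ρ ∧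
      Metric.closedBall c ρ ⊆ (P : Set (EuclideanSpace ℝ (Fin n))) := by
  obtain ⟨c, hc⟩ := P.convex.interior_nonempty_iff_affineSpan_eq_top.mpr hP.2.1
  obtain ⟨ρ, hρ, h⟩ := Metric.nhds_basis_closedBall.mem_iff.mp (mem_interior_iff_mem_nhds.mp hc)
  exact ⟨c, ρ, hρ, h⟩

/-- The point of the ball farthest in direction `u` lies within `ε` of `Q`, which bounds the support
function of `Q` from below. -/
theorem mul_norm_le_inner_of_closedBall {n : ℕ} {P Q : ConvexBody (EuclideanSpace ℝ (Fin n))}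
    {c : EuclideanSpace ℝ (Fin n)} {ρ ε : ℝ} (hρ : 0 < ρ)
    (hball : Metric.closedBall c ρ ⊆ (P : Set (EuclideanSpace ℝ (Fin n))))
    (hPQ : dist P Q < ε) {u q : EuclideanSpace ℝ (Fin n)} (hu : ∀ x ∈ Q, ⟪u, x⟫ ≤ ⟪u, q⟫) :
    (ρ - ε) * ‖u‖ ≤ ⟪u, q - c⟫ := by
  rcases eq_or_ne u 0 with rfl | h0
  · simp
  have hnu : 0 < ‖u‖ := norm_pos_iff.mpr h0
  have hx : c + (ρ / ‖u‖) • u ∈ P := by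
    refine hball ?_
    rw [Metric.mem_closedBall, dist_eq_norm, add_sub_cancel_left, norm_smul, Real.norm_eq_abs,
      abs_of_pos (by positivity), div_mul_cancel₀ _ hnu.ne']
  obtain ⟨z, hz, hxz⟩ := exists_dist_lt_of_dist_lt hPQ hx
  have h1 := inner_le_inner_add_of_norm_lt u hxz
  have h2 := hu z hz
  rw [inner_add_right, real_inner_smul_right, real_inner_self_eq_norm_sq] at h1
  have h3 : ρ / ‖u‖ * ‖u‖ ^ 2 = ρ * ‖u‖ := by field_simp
  rw [inner_sub_right]
  linarith

/-- Edges of a Delzant polygon persist in nearby Delzant polygons. -/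
theorem eventually_face_nontrivial {P : ConvexBody (EuclideanSpace ℝ (Fin 2))} (hP : IsDelzant P)
    {r : EuclideanSpace ℝ (Fin 2)} (hr : r ∈ integerLattice 2) (hr0 : r ≠ 0)
    (hface : (face (P : Set (EuclideanSpace ℝ (Fin 2))) r).Nontrivial) :
    ∀ᶠ Q in 𝓝 P, IsDelzant Q → (face (Q : Set (EuclideanSpace ℝ (Fin 2))) r).Nontrivial := by
  obtain ⟨c, ρ, hρ, hball⟩ := exists_closedBall_subset hP
  obtain ⟨D, hD⟩ := P.isBounded.subset_closedBall c
  obtain ⟨p₁, hp₁, p₂, hp₂, hne⟩ := hface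
  have hd0 : p₁ - p₂ ≠ 0 := sub_ne_zero.mpr hne
  have hrd : ⟪r, p₁ - p₂⟫ = 0 := inner_eq_of_mem_face hp₁ hp₂
  have hnr : 0 < ‖r‖ := norm_pos_iff.mpr hr0
  have hdet : 0 < |planeDet r (p₁ - p₂)| := by
    refine abs_pos.mpr fun h => ?_
    have := inner_mul_inner_self_plane r (p₁ - p₂) (p₁ - p₂) hrd
    rw [h, mul_zero, real_inner_self_eq_norm_sq] at this
    have h1 : 0 < ‖p₁ - p₂‖ := norm_pos_iff.mpr hd0
    have : 0 < ‖p₁ - p₂‖ ^ 2 * ‖r‖ ^ 2 := by positivity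
    linarith
  have hD0 : 0 ≤ D := by
    have := hD hp₁.1
    rw [Metric.mem_closedBall] at this
    exact dist_nonneg.trans this
  -- `M` bounds the generator `v 0` below: `ρ / 2 * ‖v 0‖ ≤ ⟪v 0, q - c⟫ ≤ ⟪r, q - c⟫ ≤ ‖r‖ * (D +
  -- 1)`, using `ε ≤ ρ / 2` and `ε ≤ 1`. The last condition on `ε` yields the final contradiction.
  set M : ℝ := 2 * ‖r‖ * (D + 1) / ρ with hM
  have hM0 : 0 ≤ M := by positivity
  obtain ⟨ε, hε0, hε1, hε2, hε3⟩ : ∃ ε : ℝ, 0 < ε ∧ ε ≤ 1 ∧ ε ≤ ρ / 2 ∧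
      (2 * ε * (‖r‖ + M)) * ‖r‖ ^ 2 < |planeDet r (p₁ - p₂)| := by
    have h1 : ∀ᶠ ε : ℝ in 𝓝[>] 0, ε ≤ 1 := nhdsWithin_le_nhds (Iic_mem_nhds one_pos)
    have h2 : ∀ᶠ ε : ℝ in 𝓝[>] 0, ε ≤ ρ / 2 := nhdsWithin_le_nhds (Iic_mem_nhds (half_pos hρ))
    have h3 : ∀ᶠ ε : ℝ in 𝓝[>] 0, (2 * ε * (‖r‖ + M)) * ‖r‖ ^ 2 < |planeDet r (p₁ - p₂)| := by
      refine nhdsWithin_le_nhds ?_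
      have : ContinuousAt (fun ε : ℝ => (2 * ε * (‖r‖ + M)) * ‖r‖ ^ 2) 0 := by fun_prop
      exact this.eventually_lt_const (by simpa using hdet)
    obtain ⟨ε, h, h0⟩ := ((h1.and (h2.and h3)).and self_mem_nhdsWithin).exists
    exact ⟨ε, h0, h.1, h.2.1, h.2.2⟩
  filter_upwards [Metric.ball_mem_nhds P hε0] with Q hQP hQ
  rw [Metric.mem_ball] at hQP
  have hPQ : dist P Q < ε := by rwa [dist_comm]
  have hQ' := isDelzant_iff.mp hQ
  by_contra hsing
  have hopen := hQ'.1.exists_add_smul_mem_of_subsingleton hsing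
  obtain ⟨m, v, hprim, hv, hC, hmult⟩ := hQ'.2.2 r
  have hrC := self_mem_localCone (Q : Set (EuclideanSpace ℝ (Fin 2))) r
  rw [hC] at hrC
  obtain rfl : m = 2 := eq_two_of_forall_add_smul_mem_coneOf hv hrC (by rwa [hC] at hopen)
  -- Unimodularity makes the coefficients of the lattice vector `r` integers; being positive, they
  -- are at least `1`.
  have hrcl := coneMultiplicity_eq_one_iff.mp hmult r (Submodule.subset_span hrC) hr
  obtain ⟨k, hk⟩ := exists_int_coeff_of_mem_closure hrcl
  have hkpos : ∀ i, (1 : ℝ) ≤ k i := fun i => by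
    have : (0 : ℝ) < k i := hQ'.1.pos_of_localCone_eq hv hC hk i
    exact_mod_cast (Int.cast_pos.mp this)
  obtain ⟨q, hq, hqmax⟩ := exists_inner_max Q r
  have hvmax : ∀ i, ∀ x ∈ Q, ⟪v i, x⟫ ≤ ⟪v i, q⟫ := fun i =>
    mem_localCone.mp (hC ▸ mem_coneOf_self v i) q hq hqmax
  rw [Fin.sum_univ_two] at hk
  have hinner : ∀ z, ⟪r, z⟫ = k 0 * ⟪v 0, z⟫ + k 1 * ⟪v 1, z⟫ := fun z => by
    conv_lhs => rw [hk]
    rw [inner_add_left, real_inner_smul_left, real_inner_smul_left]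
  -- the generators of the cone are bounded
  have hu : ‖v 0‖ ≤ M := by
    have b0 := mul_norm_le_inner_of_closedBall hρ hball hPQ (hvmax 0)
    have b1 := mul_norm_le_inner_of_closedBall hρ hball hPQ (hvmax 1)
    obtain ⟨z, hz, hqz⟩ := exists_dist_lt_of_dist_lt hQP hq
    have hqc : ‖q - c‖ ≤ D + 1 := by
      have h1 := hD hz
      rw [Metric.mem_closedBall, dist_eq_norm] at h1
      have := norm_add_le (q - z) (z - c)
      rw [sub_add_sub_cancel] at this
      linarith
    have h1 := real_inner_le_norm r (q - c)
    rw [hinner] at h1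
    have h2 : 0 ≤ ⟪v 1, q - c⟫ := le_trans (mul_nonneg (by linarith) (norm_nonneg _)) b1
    have h3 : 0 ≤ ⟪v 0, q - c⟫ := le_trans (mul_nonneg (by linarith) (norm_nonneg _)) b0
    have h4 := mul_nonneg (by linarith [hkpos 1] : (0 : ℝ) ≤ k 1) h2
    have h5 := mul_nonneg (by linarith [hkpos 0] : (0 : ℝ) ≤ k 0 - 1) h3
    have h6 : ‖r‖ * ‖q - c‖ ≤ ‖r‖ * (D + 1) := mul_le_mul_of_nonneg_left hqc hnr.le
    have h7 : ρ / 2 * ‖v 0‖ ≤ (ρ - ε) * ‖v 0‖ :=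
      mul_le_mul_of_nonneg_right (by linarith) (norm_nonneg _)
    rw [hM, le_div_iff₀ hρ]
    linarith
  -- the endpoints of the edge have nearly the same value
  have hnear : ∀ p ∈ face (P : Set (EuclideanSpace ℝ (Fin 2))) r,
      ⟪v 0, p⟫ ≤ ⟪v 0, q⟫ + ε * M ∧ ⟪v 0, q⟫ - 2 * ε * ‖r‖ - ε * M ≤ ⟪v 0, p⟫ := by
    rintro p ⟨hp, hpmax⟩
    obtain ⟨z, hz, hpz⟩ := exists_dist_lt_of_dist_lt hPQ hp
    have hzp : ‖z - p‖ < ε := by rwa [norm_sub_rev]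
    obtain ⟨y, hy, hqy⟩ := exists_dist_lt_of_dist_lt hQP hq
    have g1 := inner_le_inner_add_of_norm_lt (v 0) hpz
    have g2 := inner_le_inner_add_of_norm_lt (v 0) hzp
    have g3 := inner_le_inner_add_of_norm_lt r hpz
    have g4 := inner_le_inner_add_of_norm_lt r hqy
    have g5 := hpmax y hy
    have g6 : ε * ‖v 0‖ ≤ ε * M := mul_le_mul_of_nonneg_left hu hε0.le
    have g7 := hvmax 0 z hz
    -- The gap of `r` between `q` and `z` is a sum of nonnegative gaps of the `v i` with weights `k
    -- i ≥ 1`, so it dominates the gap of `v 0`; and it is at most `2 * ε * ‖r‖`.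
    have g8 := mul_nonneg (by linarith [hkpos 1] : (0 : ℝ) ≤ k 1) (sub_nonneg.mpr (hvmax 1 z hz))
    have g9 := mul_nonneg (by linarith [hkpos 0] : (0 : ℝ) ≤ k 0 - 1) (sub_nonneg.mpr g7)
    have g10 := hinner q
    have g11 := hinner z
    constructor <;> linarith
  have h1 := hnear p₁ hp₁
  have h2 := hnear p₂ hp₂
  have hsmall : |⟪v 0, p₁ - p₂⟫| ≤ 2 * ε * (‖r‖ + M) := by
    rw [inner_sub_right, abs_le]
    constructor <;> linarith [h1.1, h1.2, h2.1, h2.2]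
  -- but the generator is an integer vector not parallel to `r`
  have hint : 1 ≤ |planeDet r (v 0)| := by
    obtain ⟨r₀, e₀⟩ := hr 0
    obtain ⟨r₁, e₁⟩ := hr 1
    obtain ⟨z, hz, -⟩ := hprim 0
    have e : planeDet r (v 0) = ((r₀ * z 1 - r₁ * z 0 : ℤ) : ℝ) := by
      rw [planeDet, e₀, e₁, hz, hz]; push_cast; ring
    have hne0 : planeDet r (v 0) ≠ 0 := by
      have : planeDet r (v 0) = -(k 1 * planeDet (v 0) (v 1)) := by
        conv_lhs => rw [hk]
        simp only [planeDet, PiLp.add_apply, PiLp.smul_apply, smul_eq_mul]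
        ring
      rw [this]
      exact neg_ne_zero.mpr (mul_ne_zero (by linarith [hkpos 1])
        (planeDet_ne_zero_of_linearIndependent hv))
    rw [e] at hne0 ⊢
    exact_mod_cast Int.one_le_abs (Int.cast_ne_zero.mp hne0)
  have key := congrArg abs (inner_mul_inner_self_plane r (v 0) (p₁ - p₂) hrd)
  rw [abs_mul, abs_mul, abs_of_nonneg (sq_nonneg ‖r‖)] at key
  have k1 := mul_le_mul_of_nonneg_right hsmall (sq_nonneg ‖r‖)
  have k2 := mul_le_mul_of_nonneg_right hint hdet.le
  linarith

/-- The edges of a polygon are the faces in direction of the generators of its cones. -/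
theorem face_generator_nontrivial {P : ConvexBody (EuclideanSpace ℝ (Fin 2))} (hP : IsPolytope P)
    {m : ℕ} {v : Fin m → EuclideanSpace ℝ (Fin 2)} (hv : LinearIndependent ℝ v)
    {α : EuclideanSpace ℝ (Fin 2)}
    (hC : localCone (P : Set (EuclideanSpace ℝ (Fin 2))) α = coneOf v) (i : Fin m) :
    (face (P : Set (EuclideanSpace ℝ (Fin 2))) (v i)).Nontrivial := by
  by_contra hsing
  have hsub := localCone_subset_of_mem (hC ▸ mem_coneOf_self v i)
  rw [hC] at hsub
  have hopen : ∀ β, ∃ ε : ℝ, 0 < ε ∧ v i + ε • β ∈ coneOf v := fun β => by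
    obtain ⟨ε, hε, h⟩ := hP.exists_add_smul_mem_of_subsingleton hsing β
    exact ⟨ε, hε, hsub h⟩
  obtain rfl : m = 2 := eq_two_of_forall_add_smul_mem_coneOf hv (mem_coneOf_self v i) hopen
  obtain ⟨j, hj⟩ : ∃ j : Fin 2, j ≠ i := exists_ne i
  -- Moving from `v i` in direction `-v j` leaves the cone at once, so `v i` is not interior.
  obtain ⟨ε, hε, b, hb, e⟩ := hopen (-v j)
  have e' : ∑ l, (b l - (Pi.single i 1 : Fin 2 → ℝ) l + (Pi.single j ε : Fin 2 → ℝ) l) • v l = 0 := by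
    simp only [add_smul, sub_smul, Finset.sum_add_distrib, Finset.sum_sub_distrib, ← e]
    simp [Pi.single_apply]
  have := Fintype.linearIndependent_iff.mp hv _ e' j
  rw [Pi.single_eq_same, Pi.single_eq_of_ne hj] at this
  linarith [hb j]

/-- A positive combination of `α` and `β` is a nonnegative multiple of `w`. If the multiple is
positive, the edge of `w` lies in the face of `α` and is orthogonal to two independent vectors; if
it is zero, `β` is a negative multiple of `α`. -/
theorem notMem_localCone_of_edge {Q : ConvexBody (EuclideanSpace ℝ (Fin 2))} (hQ : IsDelzant Q)
    {u w α β : EuclideanSpace ℝ (Fin 2)} (huw : planeDet u w ≠ 0)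
    (hw : (face (Q : Set (EuclideanSpace ℝ (Fin 2))) w).Nontrivial) {a b c d : ℝ} (ha : 0 < a)
    (hα : α = a • u + b • w) (hβ : β = c • u + d • w) (hc : c < 0) (h : 0 ≤ b * -c + a * d) :
    β ∉ localCone (Q : Set (EuclideanSpace ℝ (Fin 2))) α := by
  intro hmem
  have hc' : 0 < -c := neg_pos.mpr hc
  have hγ : (-c) • α + a • β = (b * -c + a * d) • w := by
    rw [hα, hβ]; module
  have hdet : planeDet α w ≠ 0 := by
    have : planeDet α w = a * planeDet u w := by
      rw [hα]; simp only [planeDet, PiLp.add_apply, PiLp.smul_apply, smul_eq_mul]; ring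
    rw [this]
    exact mul_ne_zero ha.ne' huw
  rcases h.eq_or_lt with h0 | h0
  · rw [← h0, zero_smul] at hγ
    have hα0 : α ≠ 0 := by rintro rfl; simp [planeDet] at hdet
    have e : β = -((-c / a) • α) := by
      rw [div_eq_inv_mul, mul_smul, ← smul_neg, eq_inv_smul_iff₀ ha.ne']
      exact eq_neg_of_add_eq_zero_right hγ
    exact neg_smul_notMem_localCone hQ hα0 (div_pos hc' ha) (e ▸ hmem)
  · obtain ⟨q₁, hq₁, q₂, hq₂, hne⟩ := hw
    have hsub := face_subset_of_add hmem hc' ha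
    rw [hγ, face_smul h0] at hsub
    exact hdet (planeDet_eq_zero_of_inner_eq_zero (sub_ne_zero.mpr hne)
      (inner_eq_of_mem_face (hsub hq₁) (hsub hq₂)) (inner_eq_of_mem_face hq₁ hq₂))

/-- A cone of the fan of `Q` cannot cross a ray that is normal to an edge of `Q`, so the one at `α`
stays between the rays through the `v i`. -/
theorem localCone_subset_coneOf_of_edges {P Q : ConvexBody (EuclideanSpace ℝ (Fin 2))}
    (hP : IsPolytope P) (hQ : IsDelzant Q) {m : ℕ} {v : Fin m → EuclideanSpace ℝ (Fin 2)}
    (hv : LinearIndependent ℝ v) {α : EuclideanSpace ℝ (Fin 2)}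
    (hC : localCone (P : Set (EuclideanSpace ℝ (Fin 2))) α = coneOf v)
    (hedge : ∀ i, (face (Q : Set (EuclideanSpace ℝ (Fin 2))) (v i)).Nontrivial) :
    localCone (Q : Set (EuclideanSpace ℝ (Fin 2))) α ⊆ coneOf v := by
  intro β hβ
  have hαC := self_mem_localCone (P : Set (EuclideanSpace ℝ (Fin 2))) α
  rw [hC] at hαC
  obtain ⟨a, -, hα⟩ := hαC
  have ha := hP.pos_of_localCone_eq hv hC hα
  have hm := card_le_two_of_linearIndependent hv
  interval_cases m
  · rw [Finset.univ_eq_empty, Finset.sum_empty] at hα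
    rw [hα] at hβ
    exact ⟨a, fun i => i.elim0, by simpa using (isDelzant_iff.mp hQ).2.1 hβ⟩
  · rw [Fin.sum_univ_one] at hα
    have hv0 : v 0 ≠ 0 := hv.ne_zero 0
    have hα0 : α ≠ 0 := by rw [hα]; exact smul_ne_zero (ha 0).ne' hv0
    obtain ⟨q₁, hq₁, q₂, hq₂, hne⟩ := hedge 0
    have hfa : face (Q : Set (EuclideanSpace ℝ (Fin 2))) α = face (Q : Set _) (v 0) := by
      rw [hα, face_smul (ha 0)]
    rw [← hfa] at hq₁ hq₂
    have hdet := planeDet_eq_zero_of_inner_eq_zero (x := α) (y := β) (sub_ne_zero.mpr hne)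
      (inner_eq_of_mem_face hq₁ hq₂) (inner_eq_of_mem_face (hβ hq₁) (hβ hq₂))
    have hs : 0 < α 0 ^ 2 + α 1 ^ 2 := by
      have := real_inner_self_pos.mpr hα0
      rw [inner_plane] at this
      linarith
    have hβα : β = ((α 0 * β 0 + α 1 * β 1) / (α 0 ^ 2 + α 1 ^ 2)) • α := by
      rw [planeDet] at hdet
      apply ext_plane
      · simp only [PiLp.smul_apply, smul_eq_mul]
        rw [div_mul_eq_mul_div, eq_div_iff hs.ne']
        linear_combination -α 1 * hdet
      · simp only [PiLp.smul_apply, smul_eq_mul]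
        rw [div_mul_eq_mul_div, eq_div_iff hs.ne']
        linear_combination α 0 * hdet
    generalize (α 0 * β 0 + α 1 * β 1) / (α 0 ^ 2 + α 1 ^ 2) = k at hβα
    have hk : 0 ≤ k := by
      by_contra! hk
      exact neg_smul_notMem_localCone hQ hα0 (neg_pos.mpr hk) (by simpa [← hβα] using hβ)
    refine ⟨fun _ => k * a 0, fun _ => mul_nonneg hk (ha 0).le, ?_⟩
    rw [Fin.sum_univ_one, mul_smul, ← hα]
    exact hβα
  · rw [Fin.sum_univ_two] at hα
    have hD := planeDet_ne_zero_of_linearIndependent hv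
    have hD' : planeDet (v 1) (v 0) ≠ 0 := by
      intro h
      apply hD
      rw [planeDet] at h ⊢
      linarith
    have hβe := eq_planeDet_div_smul hD β
    generalize planeDet β (v 1) / planeDet (v 0) (v 1) = c at hβe
    generalize planeDet (v 0) β / planeDet (v 0) (v 1) = d at hβe
    have hα' : α = a 1 • v 1 + a 0 • v 0 := by rw [hα, add_comm]
    have hβe' : β = d • v 1 + c • v 0 := by rw [hβe, add_comm]
    have h0 := ha 0
    have h1 := ha 1
    -- A negative coefficient forces the other one to be negative as well, and the two resulting
    -- inequalities add up to `0 < 0`.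
    have r0 : c < 0 → a 1 * -c + a 0 * d < 0 := fun hc => by
      by_contra! h
      exact notMem_localCone_of_edge hQ hD (hedge 1) h0 hα hβe hc h hβ
    have r1 : d < 0 → a 0 * -d + a 1 * c < 0 := fun hd => by
      by_contra! h
      exact notMem_localCone_of_edge hQ hD' (hedge 0) h1 hα' hβe' hd h hβ
    have hc : 0 ≤ c := by
      by_contra! hc
      have e0 := r0 hc
      have hd : d < 0 := by nlinarith [mul_pos h1 (neg_pos.mpr hc)]
      have e1 := r1 hd
      linarith
    have hd : 0 ≤ d := by
      by_contra! hd
      nlinarith [r1 hd, mul_pos h0 (neg_pos.mpr hd), mul_nonneg h1.le hc]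
    refine ⟨![c, d], fun i => ?_, ?_⟩
    · fin_cases i
      · exact hc
      · exact hd
    · rw [Fin.sum_univ_two]
      exact hβe

/-- Delzant polygons near `P` have a normal fan refining that of `P`. -/
theorem eventually_refines {P : ConvexBody (EuclideanSpace ℝ (Fin 2))} (hP : IsDelzant P) :
    ∀ᶠ Q in 𝓝 P, IsDelzant Q → Refines Q P := by
  have hP' := isDelzant_iff.mp hP
  have key : ∀ C ∈ normalFan (P : Set (EuclideanSpace ℝ (Fin 2))), ∀ᶠ Q in 𝓝 P, IsDelzant Q →
      ∀ α, localCone (P : Set (EuclideanSpace ℝ (Fin 2))) α = C →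
        localCone (Q : Set (EuclideanSpace ℝ (Fin 2))) α ⊆ C := by
    rintro C ⟨α₀, rfl⟩
    obtain ⟨m, v, hprim, hv, hC, -⟩ := hP'.2.2 α₀
    have hedge : ∀ᶠ Q in 𝓝 P, ∀ i, IsDelzant Q →
        (face (Q : Set (EuclideanSpace ℝ (Fin 2))) (v i)).Nontrivial := by
      refine eventually_all.mpr fun i => eventually_face_nontrivial hP ?_ (hv.ne_zero i)
        (face_generator_nontrivial hP'.1 hv hC i)
      obtain ⟨z, hz, -⟩ := hprim i
      exact fun k => ⟨z k, hz k⟩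
    filter_upwards [hedge] with Q hQe hQ α hα
    have hC' : normalCone (P : Set (EuclideanSpace ℝ (Fin 2))) (face (P : Set _) α₀) = coneOf v :=
      hC
    rw [hC'] at hα ⊢
    exact localCone_subset_coneOf_of_edges hP'.1 hQ hv hα fun i => hQe i hQ
  filter_upwards [(finite_normalFan hP'.1).eventually_all.mpr key] with Q h hQ α
  exact h _ ⟨α, rfl⟩ hQ α rfl

end DelzantModuli

namespace DelzantModuli

open Filter Pointwise Topology
open scoped RealInnerProductSpace

/-! ### The Hausdorff topology -/

theorem dist_le_of_forall_exists {n : ℕ} {P Q : ConvexBody (EuclideanSpace ℝ (Fin n))} {r : ℝ}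
    (hr : 0 ≤ r) (h1 : ∀ x ∈ P, ∃ y ∈ Q, dist x y ≤ r) (h2 : ∀ y ∈ Q, ∃ x ∈ P, dist y x ≤ r) :
    dist P Q ≤ r := by
  rw [← ConvexBody.hausdorffDist_coe]
  exact Metric.hausdorffDist_le_of_mem_dist hr h1 h2

theorem exists_dist_le_dist {n : ℕ} (P Q : ConvexBody (EuclideanSpace ℝ (Fin n)))
    {x : EuclideanSpace ℝ (Fin n)} (hx : x ∈ P) : ∃ y ∈ Q, dist x y ≤ dist P Q := by
  obtain ⟨y, hy, h⟩ := Q.isCompact.exists_infDist_eq_dist Q.nonempty x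
  refine ⟨y, hy, ?_⟩
  rw [← h, ← ConvexBody.hausdorffDist_coe]
  exact Metric.infDist_le_hausdorffDist_of_mem hx ConvexBody.hausdorffEDist_ne_top

theorem dist_add_add_le_dist {n : ℕ} (P Q P' Q' : ConvexBody (EuclideanSpace ℝ (Fin n))) :
    dist (P + Q) (P' + Q') ≤ dist P P' + dist Q Q' := by
  have key : ∀ P Q P' Q' : ConvexBody (EuclideanSpace ℝ (Fin n)), ∀ x ∈ P + Q,
      ∃ y ∈ P' + Q', dist x y ≤ dist P P' + dist Q Q' := by
    rintro P Q P' Q' _ ⟨x, hx, y, hy, rfl⟩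
    obtain ⟨x', hx', h⟩ := exists_dist_le_dist P P' hx
    obtain ⟨y', hy', h'⟩ := exists_dist_le_dist Q Q' hy
    exact ⟨x' + y', Set.add_mem_add hx' hy', (dist_add_add_le _ _ _ _).trans (add_le_add h h')⟩
  refine dist_le_of_forall_exists (by positivity) (key P Q P' Q') fun y hy => ?_
  rw [dist_comm P, dist_comm Q]
  exact key P' Q' P Q y hy

/-- Corresponding points satisfy `s x - t y = s (x - y) + (s - t) y`. -/
theorem dist_smul_smul_le {n : ℕ} {P Q : ConvexBody (EuclideanSpace ℝ (Fin n))} {R : ℝ}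
    (hR : ∀ x ∈ Q, ‖x‖ ≤ R) (s t : ℝ) :
    dist (s • P) (t • Q) ≤ |s| * dist P Q + |s - t| * R := by
  have hR0 : 0 ≤ R := by
    obtain ⟨x, hx⟩ := Q.nonempty
    exact (norm_nonneg x).trans (hR x hx)
  have key : ∀ x y : EuclideanSpace ℝ (Fin n), y ∈ Q → dist x y ≤ dist P Q →
      dist (s • x) (t • y) ≤ |s| * dist P Q + |s - t| * R := by
    intro x y hy hxy
    have e : s • x - t • y = s • (x - y) + (s - t) • y := by module
    rw [dist_eq_norm] at hxy ⊢
    rw [e]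
    refine (norm_add_le _ _).trans ?_
    rw [norm_smul, norm_smul, Real.norm_eq_abs, Real.norm_eq_abs]
    exact add_le_add (mul_le_mul_of_nonneg_left hxy (abs_nonneg _))
      (mul_le_mul_of_nonneg_left (hR y hy) (abs_nonneg _))
  refine dist_le_of_forall_exists (by positivity) ?_ ?_
  · rintro _ ⟨x, hx, rfl⟩
    obtain ⟨y, hy, h⟩ := exists_dist_le_dist P Q hx
    exact ⟨t • y, Set.smul_mem_smul_set hy, key x y hy h⟩
  · rintro _ ⟨y, hy, rfl⟩
    obtain ⟨x, hx, h⟩ := exists_dist_le_dist Q P hy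
    refine ⟨s • x, Set.smul_mem_smul_set hx, ?_⟩
    have := key x y hy (by rwa [dist_comm x y, dist_comm P])
    rwa [dist_comm] at this

theorem continuous_convexBody_add {n : ℕ} :
    Continuous fun p : ConvexBody (EuclideanSpace ℝ (Fin n)) × ConvexBody (EuclideanSpace ℝ (Fin n))
      => p.1 + p.2 := by
  refine continuous_iff_continuousAt.mpr fun p => tendsto_iff_dist_tendsto_zero.mpr ?_
  refine squeeze_zero (fun _ => dist_nonneg)
    (g := fun q => dist q.1 p.1 + dist q.2 p.2) (fun q => dist_add_add_le_dist _ _ _ _) ?_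
  have : Continuous fun q : ConvexBody (EuclideanSpace ℝ (Fin n)) ×
      ConvexBody (EuclideanSpace ℝ (Fin n)) => dist q.1 p.1 + dist q.2 p.2 := by fun_prop
  simpa using this.tendsto p

theorem continuous_convexBody_smul {n : ℕ} :
    Continuous fun p : ℝ × ConvexBody (EuclideanSpace ℝ (Fin n)) => p.1 • p.2 := by
  refine continuous_iff_continuousAt.mpr fun p => tendsto_iff_dist_tendsto_zero.mpr ?_
  obtain ⟨R, hR⟩ := p.2.isBounded.exists_norm_le
  refine squeeze_zero (fun _ => dist_nonneg)
    (g := fun q => |q.1| * dist q.2 p.2 + |q.1 - p.1| * R)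
    (fun q => dist_smul_smul_le hR _ _) ?_
  have : Continuous fun q : ℝ × ConvexBody (EuclideanSpace ℝ (Fin n)) =>
    |q.1| * dist q.2 p.2 + |q.1 - p.1| * R := by fun_prop
  simpa using this.tendsto p

theorem continuous_minkowskiComb {n : ℕ} {Y : Type*} [TopologicalSpace Y]
    {f g : Y → ConvexBody (EuclideanSpace ℝ (Fin n))} {t : Y → ℝ} (hf : Continuous f)
    (hg : Continuous g) (ht : Continuous t) :
    Continuous fun y => minkowskiComb (f y) (g y) (t y) :=
  continuous_convexBody_add.comp
    ((continuous_convexBody_smul.comp ((continuous_const.sub ht).prodMk hf)).prodMk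
      (continuous_convexBody_smul.comp (ht.prodMk hg)))

theorem hausdorffTopology_eq_induced (n : ℕ) :
    hausdorffTopology n = TopologicalSpace.induced
      (Subtype.val : {P : ConvexBody (EuclideanSpace ℝ (Fin n)) // IsDelzant P} → _)
      inferInstance := by
  have h : hausdorffMetric n = PseudoMetricSpace.induced
      (Subtype.val : {P : ConvexBody (EuclideanSpace ℝ (Fin n)) // IsDelzant P} → _)
      inferInstance := by
    refine PseudoMetricSpace.ext ?_
    ext P Q
    exact ConvexBody.hausdorffDist_coe (K := P.1) (L := Q.1)
  rw [hausdorffTopology, h]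
  rfl

theorem simplyConnectedSpace_subtype_isDelzant :
    SimplyConnectedSpace {P : ConvexBody (EuclideanSpace ℝ (Fin 2)) // IsDelzant P} := by
  have : Nonempty {P : ConvexBody (EuclideanSpace ℝ (Fin 2)) // IsDelzant P} :=
    ⟨⟨_, isDelzant_fareyZonotope le_rfl⟩⟩
  refine simplyConnectedSpace_of_naturalPaths (fun P Q => Refines P.1 Q.1)
    (fun P Q h =>
      { toFun := fun t => ⟨minkowskiComb P.1 Q.1 t, P.2.minkowskiComb Q.2 h t⟩
        continuous_toFun := Continuous.subtype_mk
          (continuous_minkowskiComb continuous_const continuous_const continuous_subtype_val) _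
        source' := Subtype.ext (minkowskiComb_zero P.1 Q.1)
        target' := Subtype.ext (minkowskiComb_one P.1 Q.1) })
    (fun f g h hf hg => Continuous.subtype_mk (continuous_minkowskiComb (by fun_prop)
      (by fun_prop) (by fun_prop)) _)
    (fun Q => ?_) (fun h hP hQ t => hP.minkowskiComb hQ t)
    -- The index is shifted because the zonotope of order `0` is a single point.
    (fun N => ⟨fareyZonotope (N + 1), isDelzant_fareyZonotope (by omega)⟩)
    (fun P => (tendsto_add_atTop_nat 1).eventually (eventually_refines_fareyZonotope P.2))
  filter_upwards [continuousAt_subtype_val.eventually (eventually_refines Q.2)] with P hP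
  exact hP P.2

theorem simplyConnectedWith_hausdorffTopology : SimplyConnectedWith (hausdorffTopology 2) := by
  rw [SimplyConnectedWith, hausdorffTopology_eq_induced]
  exact simplyConnectedSpace_subtype_isDelzant

end DelzantModuli

namespace DelzantModuli

open Filter Pointwise Topology
open scoped RealInnerProductSpace

/-! ### The two metrics induce the same topology -/

section Bodies

variable {n : ℕ}

theorem closedBall_subset_of_convex {P : ConvexBody (EuclideanSpace ℝ (Fin n))}
    {c : EuclideanSpace ℝ (Fin n)} {ρ : ℝ}
    (hball : Metric.closedBall c ρ ⊆ (P : Set (EuclideanSpace ℝ (Fin n))))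
    {p : EuclideanSpace ℝ (Fin n)} (hp : p ∈ P) {l : ℝ} (h0 : 0 < l) (h1 : l ≤ 1) :
    Metric.closedBall (p + l • (c - p)) (l * ρ) ⊆ (P : Set (EuclideanSpace ℝ (Fin n))) := by
  intro y hy
  rw [Metric.mem_closedBall, dist_eq_norm] at hy
  have hw : c + l⁻¹ • (y - (p + l • (c - p))) ∈ P := by
    refine hball ?_
    rw [Metric.mem_closedBall, dist_eq_norm, add_sub_cancel_left, norm_smul, Real.norm_eq_abs,
      abs_of_pos (inv_pos.mpr h0), inv_mul_le_iff₀ h0]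
    exact hy
  have e : y = (1 - l) • p + l • (c + l⁻¹ • (y - (p + l • (c - p)))) := by
    rw [smul_add, smul_inv_smul₀ h0.ne']
    module
  rw [e]
  exact P.convex hp hw (by linarith) h0.le (by ring)

theorem exists_unit_separating {Q : ConvexBody (EuclideanSpace ℝ (Fin n))}
    {z : EuclideanSpace ℝ (Fin n)} (hz : z ∉ Q) :
    ∃ u : EuclideanSpace ℝ (Fin n), ‖u‖ = 1 ∧ ∀ q ∈ Q, ⟪u, q⟫ < ⟪u, z⟫ := by
  obtain ⟨f, s, hs, hfz⟩ := geometric_hahn_banach_closed_point Q.convex Q.isClosed hz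
  set w := (InnerProductSpace.toDual ℝ (EuclideanSpace ℝ (Fin n))).symm f with hw
  have hf : ∀ x, f x = ⟪w, x⟫ := fun x => by rw [hw, InnerProductSpace.toDual_symm_apply]
  have hlt : ∀ q ∈ Q, ⟪w, q⟫ < ⟪w, z⟫ := fun q hq => by
    rw [← hf, ← hf]; exact (hs q hq).trans hfz
  have hw0 : w ≠ 0 := by
    obtain ⟨q, hq⟩ := Q.nonempty
    intro h
    have := hlt q hq
    simp [h] at this
  have hn : 0 < ‖w‖ := norm_pos_iff.mpr hw0
  refine ⟨‖w‖⁻¹ • w, by simp [norm_smul, hn.ne'], fun q hq => ?_⟩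
  rw [real_inner_smul_left, real_inner_smul_left]
  exact mul_lt_mul_of_pos_left (hlt q hq) (inv_pos.mpr hn)

/-- The contracted point `z` is the centre of a ball of radius `l * ρ` inside `P`. A unit vector `u`
separates `z` from `Q`, and the half of that ball beyond `z` contains one of half the radius. -/
theorem ball_subset_diff_of_notMem {P Q : ConvexBody (EuclideanSpace ℝ (Fin n))}
    {c : EuclideanSpace ℝ (Fin n)} {ρ : ℝ} (hρ : 0 < ρ)
    (hball : Metric.closedBall c ρ ⊆ (P : Set (EuclideanSpace ℝ (Fin n))))
    {p : EuclideanSpace ℝ (Fin n)} (hp : p ∈ P) {l : ℝ} (h0 : 0 < l) (h1 : l ≤ 1)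
    (hz : p + l • (c - p) ∉ Q) : ∃ y, Metric.ball y (l * ρ / 2) ⊆
      (P : Set (EuclideanSpace ℝ (Fin n))) \ (Q : Set (EuclideanSpace ℝ (Fin n))) := by
  obtain ⟨u, hu, hsep⟩ := exists_unit_separating hz
  have hr : 0 < l * ρ / 2 := by positivity
  refine ⟨p + l • (c - p) + (l * ρ / 2) • u, fun y hy => ⟨?_, fun hyQ => ?_⟩⟩
  · refine closedBall_subset_of_convex hball hp h0 h1 ?_
    rw [Metric.mem_closedBall]
    refine (dist_triangle _ (p + l • (c - p) + (l * ρ / 2) • u) _).trans ?_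
    rw [Metric.mem_ball] at hy
    have : dist (p + l • (c - p) + (l * ρ / 2) • u) (p + l • (c - p)) = l * ρ / 2 := by
      rw [dist_eq_norm, add_sub_cancel_left, norm_smul, hu, Real.norm_eq_abs, abs_of_pos hr,
        mul_one]
    linarith
  · have h2 := hsep y hyQ
    rw [Metric.mem_ball, dist_comm, dist_eq_norm] at hy
    have h3 := inner_le_inner_add_of_norm_lt u hy
    rw [inner_add_right, real_inner_smul_right, real_inner_self_eq_norm_sq, hu] at h3
    linarith

theorem homothety_mem_of_dist_lt {P Q : ConvexBody (EuclideanSpace ℝ (Fin n))}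
    {c : EuclideanSpace ℝ (Fin n)} {ρ : ℝ} (hρ : 0 < ρ)
    (hball : Metric.closedBall c ρ ⊆ (P : Set (EuclideanSpace ℝ (Fin n))))
    {p : EuclideanSpace ℝ (Fin n)} (hp : p ∈ P) {l : ℝ} (h0 : 0 < l) (h1 : l ≤ 1)
    (hPQ : dist P Q < l * ρ) : p + l • (c - p) ∈ Q := by
  by_contra hz
  obtain ⟨u, hu, hsep⟩ := exists_unit_separating hz
  have hr : 0 < l * ρ := by positivity
  have hx : p + l • (c - p) + (l * ρ) • u ∈ P := by
    refine closedBall_subset_of_convex hball hp h0 h1 ?_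
    rw [Metric.mem_closedBall, dist_eq_norm, add_sub_cancel_left, norm_smul, hu, Real.norm_eq_abs,
      abs_of_pos hr, mul_one]
  obtain ⟨y, hy, hxy⟩ := exists_dist_lt_of_dist_lt hPQ hx
  have h2 := hsep y hy
  have h3 := inner_le_inner_add_of_norm_lt u hxy
  rw [inner_add_right, real_inner_smul_right, real_inner_self_eq_norm_sq, hu] at h3
  linarith

/-- If `x` in `P` is near `q`, then `q - x` is `l` times a vector of length at most `ρ`, so `q` lies
in `P + l (P - c)`, which is the enlarged copy of `P`. -/
theorem mem_homothety_of_dist_lt {P Q : ConvexBody (EuclideanSpace ℝ (Fin n))}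
    {c : EuclideanSpace ℝ (Fin n)} {ρ : ℝ}
    (hball : Metric.closedBall c ρ ⊆ (P : Set (EuclideanSpace ℝ (Fin n))))
    {l : ℝ} (h0 : 0 < l) (hPQ : dist P Q < l * ρ) {q : EuclideanSpace ℝ (Fin n)} (hq : q ∈ Q) :
    q ∈ AffineMap.homothety c (1 + l) '' (P : Set (EuclideanSpace ℝ (Fin n))) := by
  obtain ⟨x, hx, hqx⟩ := exists_dist_lt_of_dist_lt (by rwa [dist_comm] : dist Q P < l * ρ) hq
  have hl : 0 < 1 + l := by linarith
  have hw : c + l⁻¹ • (q - x) ∈ P := by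
    refine hball ?_
    rw [Metric.mem_closedBall, dist_eq_norm, add_sub_cancel_left, norm_smul, Real.norm_eq_abs,
      abs_of_pos (inv_pos.mpr h0), inv_mul_le_iff₀ h0]
    exact hqx.le
  refine ⟨(1 + l)⁻¹ • x + ((1 + l)⁻¹ * l) • (c + l⁻¹ • (q - x)),
    P.convex hx hw (by positivity) (by positivity) (by field_simp), ?_⟩
  rw [AffineMap.homothety_apply, vsub_eq_sub, vadd_eq_add, smul_sub, smul_add, mul_smul,
    smul_inv_smul₀ hl.ne', smul_inv_smul₀ hl.ne', smul_add, smul_inv_smul₀ h0.ne']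
  module

theorem measureReal_image_homothety (c : EuclideanSpace ℝ (Fin n)) {r : ℝ} (hr : 0 ≤ r)
    (s : Set (EuclideanSpace ℝ (Fin n))) :
    volume.real (AffineMap.homothety c r '' s) = r ^ n * volume.real s := by
  rw [measureReal_def, Measure.addHaar_image_homothety, finrank_euclideanSpace_fin,
    ENNReal.toReal_mul, ENNReal.toReal_ofReal (abs_nonneg _), abs_of_nonneg (pow_nonneg hr _),
    measureReal_def]

theorem ConvexBody.volume_ne_top (P : ConvexBody (EuclideanSpace ℝ (Fin n))) :
    volume (P : Set (EuclideanSpace ℝ (Fin n))) ≠ ⊤ :=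
  P.isCompact.measure_lt_top.ne

/-- The symmetric difference distance of convex bodies. -/
noncomputable def symmDiffDist (P Q : ConvexBody (EuclideanSpace ℝ (Fin n))) : ℝ :=
  volume.real ((P : Set (EuclideanSpace ℝ (Fin n))) \ Q) +
    volume.real ((Q : Set (EuclideanSpace ℝ (Fin n))) \ P)

/-- Both `P` and `Q` lie between the homothetic copies of `P` with ratios `1 - l` and `1 + l`. -/
theorem symmDiffDist_le_of_dist_lt {P Q : ConvexBody (EuclideanSpace ℝ (Fin n))}
    {c : EuclideanSpace ℝ (Fin n)} {ρ : ℝ} (hρ : 0 < ρ)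
    (hball : Metric.closedBall c ρ ⊆ (P : Set (EuclideanSpace ℝ (Fin n))))
    {l : ℝ} (h0 : 0 < l) (h1 : l ≤ 1) (hPQ : dist P Q < l * ρ) :
    symmDiffDist P Q ≤
      ((1 + l) ^ n - (1 - l) ^ n) * volume.real (P : Set (EuclideanSpace ℝ (Fin n))) := by
  have hc : c ∈ P := hball (Metric.mem_closedBall_self hρ.le)
  set A := AffineMap.homothety c (1 - l) '' (P : Set (EuclideanSpace ℝ (Fin n))) with hA
  set B := AffineMap.homothety c (1 + l) '' (P : Set (EuclideanSpace ℝ (Fin n))) with hB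
  have hcont : ∀ r : ℝ, Continuous (AffineMap.homothety c r : EuclideanSpace ℝ (Fin n) →ᵃ[ℝ] _) :=
    fun r => AffineMap.homothety_continuous c r
  have hAm : MeasurableSet A := (P.isCompact.image (hcont _)).isClosed.measurableSet
  have hBtop : volume B ≠ ⊤ := (P.isCompact.image (hcont _)).measure_lt_top.ne
  have hAP : A ⊆ P := by
    rintro _ ⟨p, hp, rfl⟩
    have e : AffineMap.homothety c (1 - l) p = (1 - l) • p + l • c := by
      rw [AffineMap.homothety_apply, vsub_eq_sub, vadd_eq_add]; module
    rw [e]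
    exact P.convex hp hc (by linarith) h0.le (by ring)
  have hAQ : A ⊆ Q := by
    rintro _ ⟨p, hp, rfl⟩
    have e : AffineMap.homothety c (1 - l) p = p + l • (c - p) := by
      rw [AffineMap.homothety_apply, vsub_eq_sub, vadd_eq_add]; module
    rw [e]
    exact homothety_mem_of_dist_lt hρ hball hp h0 h1 hPQ
  have hQB : (Q : Set (EuclideanSpace ℝ (Fin n))) ⊆ B := fun q hq =>
    mem_homothety_of_dist_lt hball h0 hPQ hq
  have hPB : (P : Set (EuclideanSpace ℝ (Fin n))) ⊆ B := fun q hq =>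
    mem_homothety_of_dist_lt hball h0 (by rw [dist_self]; positivity) hq
  have i1 : volume.real ((P : Set (EuclideanSpace ℝ (Fin n))) \ Q) ≤
      volume.real (P : Set (EuclideanSpace ℝ (Fin n))) - volume.real A := by
    rw [← measureReal_sdiff hAP hAm (ConvexBody.volume_ne_top P)]
    exact measureReal_mono (Set.sdiff_subset_sdiff_right hAQ)
      (measure_ne_top_of_subset Set.sdiff_subset (ConvexBody.volume_ne_top P))
  have i2 : volume.real ((Q : Set (EuclideanSpace ℝ (Fin n))) \ P) ≤
      volume.real B - volume.real (P : Set (EuclideanSpace ℝ (Fin n))) := by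
    rw [← measureReal_sdiff hPB P.isClosed.measurableSet hBtop]
    exact measureReal_mono (Set.sdiff_subset_sdiff_left hQB)
      (measure_ne_top_of_subset Set.sdiff_subset hBtop)
  rw [hA, measureReal_image_homothety c (by linarith)] at i1
  rw [hB, measureReal_image_homothety c (by linarith)] at i2
  rw [symmDiffDist]
  linarith

theorem exists_symmDiffDist_lt_of_dist_lt {P : ConvexBody (EuclideanSpace ℝ (Fin n))}
    (hP : IsDelzant P) {ε : ℝ} (hε : 0 < ε) :
    ∃ δ : ℝ, 0 < δ ∧ ∀ Q : ConvexBody (EuclideanSpace ℝ (Fin n)), dist P Q < δ →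
      symmDiffDist P Q < ε := by
  obtain ⟨c, ρ, hρ, hball⟩ := exists_closedBall_subset hP
  have h1 : ∀ᶠ l : ℝ in 𝓝[>] 0, l ≤ 1 := nhdsWithin_le_nhds (Iic_mem_nhds one_pos)
  have h2 : ∀ᶠ l : ℝ in 𝓝[>] 0, ((1 + l) ^ n - (1 - l) ^ n) *
      volume.real (P : Set (EuclideanSpace ℝ (Fin n))) < ε := by
    refine nhdsWithin_le_nhds ?_
    have : ContinuousAt (fun l : ℝ => ((1 + l) ^ n - (1 - l) ^ n) *
      volume.real (P : Set (EuclideanSpace ℝ (Fin n)))) 0 := by fun_prop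
    exact this.eventually_lt_const (by simpa using hε)
  obtain ⟨l, ⟨hl1, hl2⟩, hl0⟩ := ((h1.and h2).and self_mem_nhdsWithin).exists
  exact ⟨l * ρ, mul_pos hl0 hρ, fun Q hQ =>
    (symmDiffDist_le_of_dist_lt hρ hball hl0 hl1 hQ).trans_lt hl2⟩

theorem measureReal_ball_le_of_subset_diff {P Q : ConvexBody (EuclideanSpace ℝ (Fin n))}
    {y : EuclideanSpace ℝ (Fin n)} {r : ℝ}
    (h : Metric.ball y r ⊆ (P : Set (EuclideanSpace ℝ (Fin n))) \ Q) :
    volume.real (Metric.ball (0 : EuclideanSpace ℝ (Fin n)) r) ≤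
      volume.real ((P : Set (EuclideanSpace ℝ (Fin n))) \ Q) := by
  have e : volume.real (Metric.ball (0 : EuclideanSpace ℝ (Fin n)) r) =
      volume.real (Metric.ball y r) := by
    rw [measureReal_def, measureReal_def, Measure.addHaar_ball_center volume y]
  rw [e]
  exact measureReal_mono h
    (measure_ne_top_of_subset Set.sdiff_subset (ConvexBody.volume_ne_top P))

theorem measureReal_ball_pos {r : ℝ} (hr : 0 < r) :
    0 < volume.real (Metric.ball (0 : EuclideanSpace ℝ (Fin n)) r) :=
  ENNReal.toReal_pos (Metric.measure_ball_pos _ _ hr).ne' measure_ball_lt_top.ne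

theorem homothety_mem_of_measureReal_lt {P Q : ConvexBody (EuclideanSpace ℝ (Fin n))}
    {c : EuclideanSpace ℝ (Fin n)} {ρ : ℝ} (hρ : 0 < ρ)
    (hball : Metric.closedBall c ρ ⊆ (P : Set (EuclideanSpace ℝ (Fin n))))
    {l : ℝ} (h0 : 0 < l) (h1 : l ≤ 1)
    (hPQ : volume.real ((P : Set (EuclideanSpace ℝ (Fin n))) \ Q) <
      volume.real (Metric.ball (0 : EuclideanSpace ℝ (Fin n)) (l * ρ / 2)))
    {p : EuclideanSpace ℝ (Fin n)} (hp : p ∈ P) : p + l • (c - p) ∈ Q := by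
  by_contra hz
  obtain ⟨y, hy⟩ := ball_subset_diff_of_notMem hρ hball hp h0 h1 hz
  exact absurd hPQ (not_lt.mpr (measureReal_ball_le_of_subset_diff hy))

/-- If `Q` contains a fixed ball around a point of `P`, and `Q` has a point far from `P`, then
`Q \ P` contains a ball of definite size. -/
theorem infDist_le_of_measureReal_lt {P Q : ConvexBody (EuclideanSpace ℝ (Fin n))}
    {c : EuclideanSpace ℝ (Fin n)} {ρ D ε : ℝ} (hρ : 0 < ρ) (hε : 0 < ε) (hc : c ∈ P)
    (hball : Metric.closedBall c ρ ⊆ (Q : Set (EuclideanSpace ℝ (Fin n))))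
    (hD : (P : Set (EuclideanSpace ℝ (Fin n))) ⊆ Metric.closedBall c D)
    (hPQ : volume.real ((Q : Set (EuclideanSpace ℝ (Fin n))) \ P) <
      volume.real (Metric.ball (0 : EuclideanSpace ℝ (Fin n)) (ε / (D + ε + ρ) * ρ)))
    {q : EuclideanSpace ℝ (Fin n)} (hq : q ∈ Q) :
    Metric.infDist q (P : Set (EuclideanSpace ℝ (Fin n))) ≤ ε := by
  by_contra! hlt
  have hD0 : 0 ≤ D := by
    have := hD hc
    rw [Metric.mem_closedBall, dist_self] at this
    exact this
  have hcQ : c ∈ Q := hball (Metric.mem_closedBall_self hρ.le)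
  have hcont : Continuous fun t : ℝ =>
      Metric.infDist (c + t • (q - c)) (P : Set (EuclideanSpace ℝ (Fin n))) :=
    (Metric.continuous_infDist_pt _).comp (by fun_prop)
  -- Choose `y` on the segment from `c` to `q` at distance exactly `ε` from `P`, so that `‖c - y‖`
  -- is bounded however far `q` is.
  obtain ⟨t, ht, hte⟩ := intermediate_value_Icc zero_le_one hcont.continuousOn
    (show ε ∈ Set.Icc _ _ by
      simp only [zero_smul, add_zero, one_smul, add_sub_cancel]
      rw [Metric.infDist_zero_of_mem hc]
      exact ⟨hε.le, hlt.le⟩)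
  simp only at hte
  set y := c + t • (q - c) with hy
  have hyQ : y ∈ Q := by
    have e : y = (1 - t) • c + t • q := by rw [hy]; module
    rw [e]
    exact Q.convex hcQ hq (by linarith [ht.2]) ht.1 (by ring)
  obtain ⟨x, hx, hxy⟩ := P.isCompact.exists_infDist_eq_dist P.nonempty y
  have hyc : ‖c - y‖ ≤ D + ε := by
    rw [← dist_eq_norm, dist_comm]
    have h1 := dist_triangle y x c
    have h2 := hD hx
    rw [Metric.mem_closedBall] at h2
    linarith
  -- With this ratio the shift towards `c`, at most `ratio * (D + ε)`, plus the radius `ratio * ρ`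
  -- equals `ε`, so the open ball in `Q` misses `P`.
  have hs0 : 0 < ε / (D + ε + ρ) := by positivity
  have hs1 : ε / (D + ε + ρ) ≤ 1 := (div_le_one (by positivity)).mpr (by linarith)
  refine absurd hPQ (not_lt.mpr (measureReal_ball_le_of_subset_diff
    (y := y + (ε / (D + ε + ρ)) • (c - y)) fun w hw => ⟨?_, fun hwP => ?_⟩))
  · exact closedBall_subset_of_convex hball hyQ hs0 hs1 (Metric.ball_subset_closedBall hw)
  · have h1 := Metric.infDist_le_dist_of_mem (x := y) hwP
    rw [hte] at h1
    rw [Metric.mem_ball] at hw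
    have h2 := dist_triangle w (y + (ε / (D + ε + ρ)) • (c - y)) y
    have h3 : dist (y + (ε / (D + ε + ρ)) • (c - y)) y ≤ ε / (D + ε + ρ) * (D + ε) := by
      rw [dist_eq_norm, add_sub_cancel_left, norm_smul, Real.norm_eq_abs, abs_of_pos hs0]
      exact mul_le_mul_of_nonneg_left hyc hs0.le
    have h4 : ε / (D + ε + ρ) * (D + ε) + ε / (D + ε + ρ) * ρ = ε := by
      field_simp
    rw [dist_comm] at h1
    linarith

theorem exists_dist_lt_of_symmDiffDist_lt {P : ConvexBody (EuclideanSpace ℝ (Fin n))}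
    (hP : IsDelzant P) {ε : ℝ} (hε : 0 < ε) :
    ∃ δ : ℝ, 0 < δ ∧ ∀ Q : ConvexBody (EuclideanSpace ℝ (Fin n)), symmDiffDist P Q < δ →
      dist P Q ≤ ε := by
  obtain ⟨c, ρ, hρ, hball⟩ := exists_closedBall_subset hP
  obtain ⟨D, hD⟩ := P.isBounded.subset_closedBall c
  have hc : c ∈ P := hball (Metric.mem_closedBall_self hρ.le)
  have hD0 : 0 ≤ D := by
    have := hD hc
    rw [Metric.mem_closedBall, dist_self] at this
    exact this
  have hl0 : 0 < ε / (D + ε) := by positivity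
  have hl1 : ε / (D + ε) ≤ 1 := (div_le_one (by positivity)).mpr (by linarith)
  -- The first volume puts a contraction of `P` moving points by at most `ε` inside `Q`. The second
  -- puts the ball of radius `ρ / 2` about `c` inside `Q`, and with that ball the third keeps `Q`
  -- within `ε` of `P`.
  refine ⟨min (volume.real (Metric.ball (0 : EuclideanSpace ℝ (Fin n)) (ε / (D + ε) * ρ / 2)))
    (min (volume.real (Metric.ball (0 : EuclideanSpace ℝ (Fin n)) (1 / 2 * ρ / 2)))
      (volume.real (Metric.ball (0 : EuclideanSpace ℝ (Fin n))
        (ε / (D + ε + ρ / 2) * (ρ / 2))))), ?_, fun Q hQ => ?_⟩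
  · refine lt_min (measureReal_ball_pos (by positivity)) (lt_min ?_ ?_) <;>
      exact measureReal_ball_pos (by positivity)
  rw [lt_min_iff, lt_min_iff, symmDiffDist] at hQ
  obtain ⟨hQ1, hQ2, hQ3⟩ := hQ
  have p1 : 0 ≤ volume.real ((P : Set (EuclideanSpace ℝ (Fin n))) \ Q) := measureReal_nonneg
  have p2 : 0 ≤ volume.real ((Q : Set (EuclideanSpace ℝ (Fin n))) \ P) := measureReal_nonneg
  refine dist_le_of_forall_exists hε.le (fun x hx => ?_) (fun y hy => ?_)
  · refine ⟨_, homothety_mem_of_measureReal_lt hρ hball hl0 hl1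
      ((le_add_of_nonneg_right p2).trans_lt hQ1) hx, ?_⟩
    have h := hD hx
    rw [Metric.mem_closedBall, dist_comm, dist_eq_norm] at h
    rw [dist_comm, dist_eq_norm, add_sub_cancel_left, norm_smul, Real.norm_eq_abs, abs_of_pos hl0,
      div_mul_eq_mul_div, div_le_iff₀ (by positivity)]
    exact mul_le_mul_of_nonneg_left (by linarith) hε.le
  · have hballQ : Metric.closedBall c (ρ / 2) ⊆ (Q : Set (EuclideanSpace ℝ (Fin n))) := by
      intro w hw
      rw [Metric.mem_closedBall, dist_eq_norm] at hw
      have hp : c + (2 : ℝ) • (w - c) ∈ P := by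
        refine hball ?_
        rw [Metric.mem_closedBall, dist_eq_norm, add_sub_cancel_left, norm_smul]
        norm_num
        linarith
      have := homothety_mem_of_measureReal_lt hρ hball (by norm_num : (0 : ℝ) < 1 / 2)
        (by norm_num)
        ((le_add_of_nonneg_right p2).trans_lt hQ2) hp
      have e : c + (2 : ℝ) • (w - c) + (1 / 2 : ℝ) • (c - (c + (2 : ℝ) • (w - c))) = w := by
        module
      rwa [e] at this
    have := infDist_le_of_measureReal_lt (half_pos hρ) hε hc hballQ hD
      ((le_add_of_nonneg_left p1).trans_lt hQ3) hy
    obtain ⟨x, hx, hxy⟩ := P.isCompact.exists_infDist_eq_dist P.nonempty y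
    exact ⟨x, hx, by rwa [← hxy]⟩

end Bodies

theorem hausdorffTopology_eq_symmDiffTopology (n : ℕ) :
    hausdorffTopology n = symmDiffTopology n := by
  refine TopologicalSpace.ext_nhds fun P => ?_
  refine (@Metric.nhds_basis_ball _ (hausdorffMetric n) P).ext
    (@Metric.nhds_basis_ball _ (symmDiffMetric n) P) (fun ε hε => ?_) (fun ε hε => ?_)
  · obtain ⟨δ, hδ, h⟩ := exists_dist_lt_of_symmDiffDist_lt P.2 (half_pos hε)
    refine ⟨δ, hδ, fun Q hQ => ?_⟩
    have hQ' : symmDiffDist P.1 Q.1 < δ := by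
      have : (symmDiffMetric n).dist Q P < δ := hQ
      rw [(symmDiffMetric n).dist_comm] at this
      exact this
    have h2 := (h Q.1 hQ').trans_lt (half_lt_self hε)
    rw [dist_comm, ← ConvexBody.hausdorffDist_coe] at h2
    exact h2
  · obtain ⟨δ, hδ, h⟩ := exists_symmDiffDist_lt_of_dist_lt P.2 hε
    refine ⟨δ, hδ, fun Q hQ => ?_⟩
    have hQ' : dist P.1 Q.1 < δ := by
      rw [dist_comm, ← ConvexBody.hausdorffDist_coe]
      exact hQ
    have h2 : (symmDiffMetric n).dist P Q < ε := h Q.1 hQ'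
    rw [(symmDiffMetric n).dist_comm] at h2
    exact h2

end DelzantModuli

/-- The space `𝒟(2)` of Delzant polygons is simply connected, both in the topology induced by the
Hausdorff distance and in the one induced by the symmetric difference distance. -/
theorem mainTheorem9 :
    DelzantModuli.SimplyConnectedWith (DelzantModuli.hausdorffTopology 2) ∧
      DelzantModuli.SimplyConnectedWith (DelzantModuli.symmDiffTopology 2) := by
  have h := DelzantModuli.simplyConnectedWith_hausdorffTopology
  exact ⟨h, DelzantModuli.hausdorffTopology_eq_symmDiffTopology 2 ▸ h⟩
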